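/- Let $F'$ be a number field, $F/F'$ a quadratic extension with Galois group $G=\mathrm{Gal}(F/F')$, and $\chi:G\to\{\pm1\}$ the non-trivial character. Put $n=[F:\mathbb Q]$, let $S=\{\infty\}\cup S^\infty$ with $S^\infty$ a finite set of primes unramified in $F/\mathbb Q$, and let $N=\prod_{p\in S^\infty}p$. For a place $v\mid p$ of $F$ let $F_v$ be the completion, $n_v=[F_v:\mathbb Q_p]$ (with $\mathbb Q_\infty=\mathbb R$), and $|\cdot|_p$ the absolute value on $F_v$ extending the usual one of $\mathbb Q_p$. *Parameter space.* Let $T_S^1\subset\prod_{v\mid\infty}\mathbb R_{>0}\times\prod_{p\in S^\infty}\prod_{v\mid p}p^{\mathbb Z}$ be the subgroup of all $t$ with $\prod_{v\mid p}t_v^{n_v}=1$ for every $p\in S$, with the topology induced by $\mathbb R_{>0}$ and the discrete groups $p^{\mathbb Z}$. $G$ acts by $(st)_v=t_{s^{-1}v}$; for a subgroup $M\subset T_S^1$ put $M^\chi=\{t\in M: st=t^{\chi(s)}\text{ for all }s\in G\}$. *Heegner object.* Let $\mathfrak h_S=GL_n(\mathbb R)/\mathbb R^\times O(n)\times\prod_{p\in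 S^\infty}GL_n(\mathbb Q_p)/\mathbb Q_p^\times GL_n(\mathbb Z_p)$, on which $SL_n(\mathbb Z[1/N])$ acts from the left, and let $\pi:\mathfrak h_S\to SL_n(\mathbb Z[1/N])\backslash\mathfrak h_S$ be the projection (with the quotient topologies). Identify $\mathbb C\simeq\mathbb R^2$ by imaginary and real parts, fix isomorphisms $\mathcal O_v\simeq\mathbb Z_p^{n_v}$, hence $F_v\simeq\mathbb Q_p^{n_v}$, for $v\mid p\in S^\infty$, and fix an ordering of the coordinates. Let $w={}^t(w_1,\dots,w_n)$ be a basis of $F$ over $\mathbb Q$ and let $(e_v)_{v\mid p\in S^\infty}$ be integers. Writing $v(w)$ for the $n\times n_v$ matrix whose rows are the images of $w_1,\dots,w_n$ in $F_v$, let $\varpi_S:T_S^1\to\mathfrak h_S$ be the map whose component at $\infty$ is the class of the matrix with column blocks $t_v\,v(w)$, $v\mid\infty$, and whose component at $p\in S^\infty$ is the class of the matrix with column blocks $p^{e_v}t_v^{-1}v(w)$, $v\mid p$. Let $\varpi_S^\chi$ be its restriction to $(T_S^1)^\chi$. *Periods.* Let $\Lambda_{\varpi_S}$ be the group of all $\rho\in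 T_S^1$ for which there is $A\in SL_n(\mathbb Z[1/N])$ with $A\varpi_S(t)=\varpi_S(\rho t)$ for all $t\in T_S^1$. Let $\mathcal O_{w,S}=\{\lambda\in F:Aw=\lambda w\text{ for some }A\in M_n(\mathbb Z[1/N])\}$, let $\mathcal O_{w,S}^1$ be the group of its units of norm $1$ over $\mathbb Q$, and let $L(\mathcal O_{w,S}^1)\subset T_S^1$ be its image under $L:\epsilon\mapsto(|\epsilon|_p)_{v\mid p\in S}$. **Theorem 2.10.** Let $\Lambda$ be either $\Lambda_{\varpi_S}$ or $L(\mathcal O_{w,S}^1)$. Then the quotient $(T_S^1)^\chi/\Lambda^\chi$ is compact. Moreover, the image of $\pi\circ\varpi_S^\chi$ in $SL_n(\mathbb Z[1/N])\backslash\mathfrak h_S$ is compact. -/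

import Mathlib

open NumberField IsDedekindDomain Module
open scoped Matrix

noncomputable section

namespace Heegner

/-! ### Places above a rational prime and their completions -/

instance natPrimes_fact (p : Nat.Primes) : Fact (p : ℕ).Prime := ⟨p.2⟩

/-- The (finite) places of the number field `F` above the rational prime `p`. -/
abbrev PlaceAbove (F : Type*) [Field F] [NumberField F] (p : Nat.Primes) : Type _ :=
  {v : HeightOneSpectrum (𝓞 F) // ((p : ℕ) : 𝓞 F) ∈ v.asIdeal}

instance placeAbove_finite (F : Type*) [Field F] [NumberField F] (p : Nat.Primes) :
    Finite (PlaceAbove F p) := by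
  have h : Ideal.span {((p : ℕ) : 𝓞 F)} ≠ ⊥ := by
    simpa using p.2.ne_zero
  refine (Set.Finite.subset (Ideal.finite_factors h) ?_ :
    {v : HeightOneSpectrum (𝓞 F) | ((p : ℕ) : 𝓞 F) ∈ v.asIdeal}.Finite)
  intro v hv
  simpa [Ideal.dvd_span_singleton] using hv

instance placeAbove_fintype (F : Type*) [Field F] [NumberField F] (p : Nat.Primes) :
    Fintype (PlaceAbove F p) := Fintype.ofFinite _

instance placeAbove_liesOver {F : Type*} [Field F] [NumberField F] {p : Nat.Primes}
    (v : PlaceAbove F p) : v.1.asIdeal.LiesOver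
      ((Rat.HeightOneSpectrum.primesEquiv (R := ℤ)).symm p).asIdeal := by
  set u := (Rat.HeightOneSpectrum.primesEquiv (R := ℤ)).symm p with hu
  have hmem : ∀ x ∈ u.asIdeal, x ∈ v.1.asIdeal.comap (algebraMap ℤ (𝓞 F)) := by
    have hgen : Rat.HeightOneSpectrum.natGenerator u = (p : ℕ) :=
      congrArg Subtype.val ((Rat.HeightOneSpectrum.primesEquiv (R := ℤ)).apply_symm_apply p)
    have hspan := Rat.HeightOneSpectrum.span_natGenerator u
    rw [hgen] at hspan
    intro x hx
    have hx' : Rat.IsIntegralClosure.intEquiv ℤ x ∈ Ideal.span {((p : ℕ) : ℤ)} := by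
      rw [hspan]
      exact Ideal.mem_map_of_mem _ hx
    have hid : Rat.IsIntegralClosure.intEquiv ℤ x = x := by
      simp
    rw [hid, Ideal.mem_span_singleton] at hx'
    obtain ⟨y, rfl⟩ := hx'
    rw [Ideal.mem_comap, map_mul]
    exact Ideal.mul_mem_right _ _ (by simp [v.2])
  refine ⟨?_⟩
  refine u.isMaximal.eq_of_le ?_ hmem
  exact (Ideal.IsPrime.comap (algebraMap ℤ (𝓞 F))).ne_top

/-- The canonical continuous embedding of `ℚ_p` into the completion `F_v`, for `v ∣ p`: the extension
to the completions of the inclusion of `ℚ` into `F`. -/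
def padicToCompletion {F : Type*} [Field F] [NumberField F] {p : Nat.Primes}
    (v : PlaceAbove F p) : ℚ_[p] →+* v.1.adicCompletion F :=
  let u := (Rat.HeightOneSpectrum.primesEquiv (R := ℤ)).symm p
  ((HeightOneSpectrum.adicCompletion.equiv F v.1).symm.toRingHom.comp
    (UniformSpace.Completion.mapRingHom
      (algebraMap (WithVal (u.valuation ℚ)) (WithVal (v.1.valuation F)))
      (HeightOneSpectrum.uniformContinuous_algebraMap_liesOver ℚ F u v.1).continuous)).comp
    ((HeightOneSpectrum.adicCompletion.equiv ℚ u).toRingHom.comp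
      (Padic.adicCompletionEquiv ℤ p).toRingEquiv.toRingHom)

/-- `F_v` as an algebra over `ℚ_p`; the local degree `n_v` is its `finrank` over `ℚ_p`. -/
instance padicAlgebra {F : Type*} [Field F] [NumberField F] {p : Nat.Primes}
    (v : PlaceAbove F p) : Algebra ℚ_[p] (v.1.adicCompletion F) :=
  (padicToCompletion v).toAlgebra

theorem padicToCompletion_continuous {F : Type*} [Field F] [NumberField F] {p : Nat.Primes}
    (v : PlaceAbove F p) : Continuous (padicToCompletion v) := by
  let u := (Rat.HeightOneSpectrum.primesEquiv (R := ℤ)).symm p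
  exact (HeightOneSpectrum.adicCompletion.uniformEquiv F v.1).symm.continuous.comp
    ((UniformSpace.Completion.continuous_map).comp
      ((HeightOneSpectrum.adicCompletion.uniformEquiv ℚ u).continuous.comp
        (Padic.adicCompletionEquiv ℤ p).continuous))

/-- A choice, for every place `v ∣ p`, of an isomorphism of `O_v` with `ℤ_p ^ n_v`, extended to an
isomorphism of `F_v` with `ℚ_p ^ n_v`: a `ℚ_p`-basis of `F_v` for which the ring of integers `O_v` is
the set of elements with coordinates in `ℤ_p`. -/
structure LocalFrame (F : Type*) [Field F] [NumberField F] (p : Nat.Primes) where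
  basis : ∀ v : PlaceAbove F p,
    Basis (Fin (finrank ℚ_[p] (v.1.adicCompletion F))) ℚ_[p] (v.1.adicCompletion F)
  integral : ∀ (v : PlaceAbove F p) (x : v.1.adicCompletion F),
    x ∈ v.1.adicCompletionIntegers F ↔ ∀ k, ‖(basis v).repr x k‖ ≤ 1

/-- The coordinate with index `s = (v, k)` of the image of `a : F` in `∏_{v ∣ p} F_v = ℚ_p ^ n`. -/
def LocalFrame.coord {F : Type*} [Field F] [NumberField F] {p : Nat.Primes} (b : LocalFrame F p)
    (s : Σ v : PlaceAbove F p, Fin (finrank ℚ_[p] (v.1.adicCompletion F))) (a : F) : ℚ_[p] :=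
  (b.basis s.1).repr (algebraMap F _ a) s.2

theorem valued_algebraMap {F : Type*} [Field F] [NumberField F]
    (v : HeightOneSpectrum (𝓞 F)) (a : F) :
    Valued.v (algebraMap F (v.adicCompletion F) a) = v.valuation F a :=
  HeightOneSpectrum.valuedAdicCompletion_eq_valuation' v a

theorem exists_approx {F : Type*} [Field F] [NumberField F] {p : Nat.Primes}
    (v : PlaceAbove F p) (c : v.1.adicCompletion F) (m : ℕ) :
    ∃ a : F, Valued.v (c - algebraMap F (v.1.adicCompletion F) a) ≤ v.1.valuation F ((p : ℕ) : F) ^ m ∧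
     ∀ v' : PlaceAbove F p, v' ≠ v → v'.1.valuation F a ≤ v'.1.valuation F ((p : ℕ) : F) ^ m := by
  classical
  have hp : ((p : ℕ) : F) ≠ 0 := by exact_mod_cast p.2.ne_zero
  have hv0 : ∀ v' : PlaceAbove F p, v'.1.valuation F ((p : ℕ) : F) ^ m ≠ 0 :=
    fun v' ↦ pow_ne_zero _ ((Valuation.ne_zero_iff _).2 hp)
  obtain ⟨a, ha⟩ : ∃ a : F, Valued.v (c - algebraMap F (v.1.adicCompletion F) a) ≤
      v.1.valuation F ((p : ℕ) : F) ^ m := by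
    have hq : algebraMap F (v.1.adicCompletion F) (((p : ℕ) : F) ^ m) ≠ 0 :=
      (map_ne_zero _).2 (pow_ne_zero _ hp)
    have hopen : IsOpen {x : v.1.adicCompletion F |
        Valued.v ((algebraMap F (v.1.adicCompletion F) (((p : ℕ) : F) ^ m))⁻¹ * (x - c)) ≤ 1} :=
      (Valued.isOpen_integer (v.1.adicCompletion F)).preimage
        (continuous_const.mul (continuous_id.sub continuous_const))
    have hc : c ∈ {x : v.1.adicCompletion F |
        Valued.v ((algebraMap F (v.1.adicCompletion F) (((p : ℕ) : F) ^ m))⁻¹ * (x - c)) ≤ 1} := by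
      simp
    obtain ⟨a, ha⟩ := (v.1.denseRange_algebraMap F).exists_mem_open hopen ⟨c, hc⟩
    refine ⟨a, ?_⟩
    rw [Set.mem_ofPred_eq, map_mul, map_inv₀, valued_algebraMap, map_pow,
      ← div_eq_inv_mul, div_le_one₀ (zero_lt_iff.2 (hv0 v))] at ha
    rwa [Valuation.map_sub_swap]
  have hM : ∃ M : ℕ, ∀ v' : PlaceAbove F p, WithZero.exp (-(M : ℤ)) * v'.1.valuation F a ≤
      v'.1.valuation F ((p : ℕ) : F) ^ m := by
    have h1 : ∀ v' : PlaceAbove F p, ∃ M : ℕ, ∀ k : ℕ, M ≤ k →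
        WithZero.exp (-(k : ℤ)) * v'.1.valuation F a ≤ v'.1.valuation F ((p : ℕ) : F) ^ m := by
      intro v'
      rcases eq_or_ne (v'.1.valuation F a) 0 with h0 | h0
      · exact ⟨0, fun k _ ↦ by simp [h0]⟩
      · obtain ⟨M, hM⟩ := WithZero.exists_exp_neg_natCast_lt
          (div_ne_zero (hv0 v') h0)
        refine ⟨M, fun k hk ↦ ?_⟩
        have h2 : (WithZero.exp (-(k : ℤ)) : WithZero (Multiplicative ℤ)) ≤ WithZero.exp (-(M : ℤ)) := by
          rw [WithZero.exp_le_exp]; omega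
        exact (mul_le_mul_left h2 _).trans ((le_div_iff₀ (zero_lt_iff.2 h0)).1 hM.le)
    choose M hM using h1
    exact ⟨Finset.univ.sup M, fun v' ↦ hM v' _ (Finset.le_sup (Finset.mem_univ v'))⟩
  obtain ⟨M, hM⟩ := hM
  obtain ⟨y, hy⟩ := IsDedekindDomain.exists_forall_sub_mem_ideal
    (s := (Finset.univ : Finset (PlaceAbove F p))) (fun v' ↦ v'.1.asIdeal) (fun _ ↦ M)
    (fun v' _ ↦ v'.1.prime)
    (fun v' _ v'' _ h h' ↦ h (Subtype.ext (HeightOneSpectrum.ext h')))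
    (fun v' ↦ if v'.1 = v then 1 else 0)
  have hy' : ∀ v' : PlaceAbove F p,
      v'.1.valuation F (algebraMap (𝓞 F) F (y - if v' = v then 1 else 0)) ≤ WithZero.exp (-(M : ℤ)) := by
    intro v'
    rw [HeightOneSpectrum.valuation_of_algebraMap, HeightOneSpectrum.intValuation_le_pow_iff_mem]
    exact hy v' (Finset.mem_univ _)
  refine ⟨a * algebraMap (𝓞 F) F y, ?_, fun v' hv' ↦ ?_⟩
  · have h1 : c - algebraMap F (v.1.adicCompletion F) (a * algebraMap (𝓞 F) F y) =
        (c - algebraMap F (v.1.adicCompletion F) a) -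
          algebraMap F (v.1.adicCompletion F) (algebraMap (𝓞 F) F (y - 1) * a) := by
      rw [map_mul (algebraMap F (v.1.adicCompletion F)), map_mul (algebraMap F (v.1.adicCompletion F)),
        map_sub (algebraMap (𝓞 F) F), map_sub (algebraMap F (v.1.adicCompletion F)), map_one, map_one]
      ring
    rw [h1]
    refine (Valuation.map_sub _ _ _).trans (max_le ha ?_)
    rw [valued_algebraMap, map_mul]
    refine le_trans (mul_le_mul_left ?_ _) (hM v)
    simpa using hy' v
  · rw [mul_comm, map_mul]
    refine le_trans (mul_le_mul_left ?_ _) (hM v')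
    simpa [hv'] using hy' v'

theorem LocalFrame.norm_repr_le {F : Type*} [Field F] [NumberField F] {p : Nat.Primes}
    (b : LocalFrame F p) (v : PlaceAbove F p) (x : v.1.adicCompletion F) (m : ℕ)
    (k : Fin (finrank ℚ_[p] (v.1.adicCompletion F)))
    (hx : Valued.v x ≤ v.1.valuation F ((p : ℕ) : F) ^ m) :
    ‖(b.basis v).repr x k‖ ≤ ‖((p : ℕ) : ℚ_[p])‖ ^ m := by
  have hp0 : ((p : ℕ) : F) ≠ 0 := by exact_mod_cast p.2.ne_zero
  have hpQ : ((p : ℕ) : ℚ_[p]) ≠ 0 := by exact_mod_cast p.2.ne_zero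
  have hval : Valued.v (algebraMap ℚ_[p] (v.1.adicCompletion F) ((p : ℕ) : ℚ_[p])) =
      v.1.valuation F ((p : ℕ) : F) := by
    rw [← valued_algebraMap, map_natCast (algebraMap ℚ_[p] _),
      map_natCast (algebraMap F (v.1.adicCompletion F))]
  have hmem : ((((p : ℕ) : ℚ_[p]) ^ m)⁻¹ • x) ∈ v.1.adicCompletionIntegers F := by
    rw [HeightOneSpectrum.mem_adicCompletionIntegers, Algebra.smul_def, map_inv₀, map_pow, map_mul,
      map_inv₀, map_pow, hval, ← div_eq_inv_mul]
    exact (div_le_one₀ (zero_lt_iff.2 (pow_ne_zero _ ((Valuation.ne_zero_iff _).2 hp0)))).2 hx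
  have h2 := (b.integral v _).1 hmem k
  rw [map_smul, Finsupp.smul_apply, smul_eq_mul, norm_mul, norm_inv, norm_pow,
    ← div_eq_inv_mul, div_le_one₀ (pow_pos (norm_pos_iff.2 hpQ) m)] at h2
  exact h2

theorem LocalFrame.coord_eq_sum {F : Type*} [Field F] [NumberField F] {p : Nat.Primes} {n : ℕ}
    (b : LocalFrame F p) (w : Basis (Fin n) ℚ F) (a : F)
    (s : Σ v : PlaceAbove F p, Fin (finrank ℚ_[p] (v.1.adicCompletion F))) :
    b.coord s a = ∑ i, ((w.repr a i : ℚ) : ℚ_[p]) * b.coord s (w i) := by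
  have hrat : ∀ (q : ℚ) (x : s.1.1.adicCompletion F),
      algebraMap F (s.1.1.adicCompletion F) (algebraMap ℚ F q) * x = (q : ℚ_[p]) • x := by
    intro q x
    rw [Algebra.smul_def]
    congr 1
    rw [eq_ratCast, map_ratCast, map_ratCast]
  have hexp : algebraMap F (s.1.1.adicCompletion F) a =
      ∑ i, ((w.repr a i : ℚ) : ℚ_[p]) • algebraMap F (s.1.1.adicCompletion F) (w i) := by
    conv_lhs => rw [← w.sum_repr a]
    rw [map_sum]
    refine Finset.sum_congr rfl fun i _ ↦ ?_
    rw [Algebra.smul_def, map_mul, hrat]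
  unfold LocalFrame.coord
  rw [hexp, map_sum, Finsupp.finsetSum_apply]
  refine Finset.sum_congr rfl fun i _ ↦ ?_
  rw [map_smul, Finsupp.smul_apply, smul_eq_mul]

open Classical in
theorem LocalFrame.exists_coord_approx {F : Type*} [Field F] [NumberField F] {p : Nat.Primes}
    (b : LocalFrame F p)
    (s₀ : Σ v : PlaceAbove F p, Fin (finrank ℚ_[p] (v.1.adicCompletion F))) (m : ℕ) :
    ∃ a : F, ∀ s, ‖(if s = s₀ then 1 else 0) - b.coord s a‖ ≤ ‖((p : ℕ) : ℚ_[p])‖ ^ m := by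
  obtain ⟨v₀, k₀⟩ := s₀
  obtain ⟨a, ha, ha'⟩ := exists_approx v₀ (b.basis v₀ k₀) m
  refine ⟨a, ?_⟩
  rintro ⟨v, k⟩
  by_cases h : v = v₀
  · subst h
    have h1 := b.norm_repr_le v _ m k ha
    rw [map_sub, Finsupp.sub_apply, Basis.repr_self, Finsupp.single_apply] at h1
    simpa [eq_comm, LocalFrame.coord] using h1
  · have h1 := b.norm_repr_le v (algebraMap F _ a) m k
      ((valued_algebraMap v.1 a).trans_le (ha' v h))
    rw [if_neg (fun h' ↦ h (congrArg Sigma.fst h')), zero_sub, norm_neg]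
    exact h1

/-- The image of a `ℚ`-basis of `F` in `∏_{v ∣ p} F_v = ℚ_p ^ n` is a `ℚ_p`-basis. -/
theorem LocalFrame.det_ne_zero {F : Type*} [Field F] [NumberField F] {p : Nat.Primes}
    {n : ℕ} (w : Basis (Fin n) ℚ F) (b : LocalFrame F p)
    (c : Fin n ≃ Σ v : PlaceAbove F p, Fin (finrank ℚ_[p] (v.1.adicCompletion F))) :
    (Matrix.of fun i j : Fin n ↦ b.coord (c j) (w i)).det ≠ 0 := by
  classical
  intro hdet
  obtain ⟨y, hy0, hy⟩ := Matrix.exists_mulVec_eq_zero_iff.2 hdet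
  apply hy0
  have hF : ∀ a : F, ∑ j, b.coord (c j) a * y j = 0 := by
    intro a
    simp_rw [fun j ↦ b.coord_eq_sum w a (c j), Finset.sum_mul, mul_assoc]
    rw [Finset.sum_comm]
    refine Finset.sum_eq_zero fun i _ ↦ ?_
    rw [← Finset.mul_sum]
    have := congrFun hy i
    simp only [Matrix.mulVec, dotProduct, Matrix.of_apply, Pi.zero_apply] at this
    rw [this, mul_zero]
  funext j₀
  have hlim : ∀ m : ℕ, ‖y j₀‖ ≤ ‖((p : ℕ) : ℚ_[p])‖ ^ m * ∑ j, ‖y j‖ := by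
    intro m
    obtain ⟨a, ha⟩ := b.exists_coord_approx (c j₀) m
    have hsum : y j₀ = ∑ j, ((if c j = c j₀ then 1 else 0) - b.coord (c j) a) * y j := by
      simp only [sub_mul, Finset.sum_sub_distrib, hF a, c.injective.eq_iff]
      simp
    calc ‖y j₀‖ = ‖∑ j, ((if c j = c j₀ then 1 else 0) - b.coord (c j) a) * y j‖ :=
          congrArg _ hsum
      _ ≤ ∑ j, ‖((p : ℕ) : ℚ_[p])‖ ^ m * ‖y j‖ := (norm_sum_le _ _).trans
        (Finset.sum_le_sum fun j _ ↦ by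
          rw [norm_mul]; exact mul_le_mul_of_nonneg_right (ha (c j)) (norm_nonneg _))
      _ = _ := (Finset.mul_sum _ _ _).symm
  have ht : Filter.Tendsto (fun m : ℕ ↦ ‖((p : ℕ) : ℚ_[p])‖ ^ m * ∑ j, ‖y j‖)
      Filter.atTop (nhds 0) := by
    have h := (tendsto_pow_atTop_nhds_zero_of_lt_one (norm_nonneg _)
      (Padic.norm_p_lt_one (p := (p : ℕ)))).mul_const (∑ j, ‖y j‖)
    rwa [zero_mul] at h
  exact norm_le_zero_iff.1 (ge_of_tendsto' ht hlim)

open mixedEmbedding in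
/-- The image of a `ℚ`-basis of `F` in `ℝ ^ r₁ × ℂ ^ r₂ = ℝ ^ n` is an `ℝ`-basis. The coordinates are
those given by the real places, and by the real and imaginary parts at the complex places. -/
theorem infiniteMatrix_det_ne_zero {F : Type*} [Field F] [NumberField F]
    {n : ℕ} (w : Basis (Fin n) ℚ F) (c : Fin n ≃ index F) :
    (Matrix.of fun i j : Fin n ↦
      (stdBasis F).repr (mixedEmbedding F (w i)) (c j)).det ≠ 0 := by
  classical
  intro hdet
  obtain ⟨y, hy0, hy⟩ := Matrix.exists_mulVec_eq_zero_iff.2 hdet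
  apply hy0
  let l : mixedSpace F →ₗ[ℝ] ℝ := ∑ j, y j • ((stdBasis F).coord (c j))
  have hl : ∀ x, l x = ∑ j, (stdBasis F).repr x (c j) * y j := by
    intro x
    simp [l, mul_comm]
  have hw : ∀ i, l (mixedEmbedding F (w i)) = 0 := by
    intro i
    rw [hl]
    have := congrFun hy i
    simpa only [Matrix.mulVec, dotProduct, Matrix.of_apply, Pi.zero_apply] using this
  have hF : ∀ a : F, l (mixedEmbedding F a) = 0 := by
    intro a
    conv_lhs => rw [← w.sum_repr a]
    rw [map_sum, map_sum]
    refine Finset.sum_eq_zero fun i _ ↦ ?_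
    rw [map_rat_smul, ← Rat.cast_smul_eq_qsmul ℝ, map_smul, hw, smul_zero]
  have hl0 : l = 0 := (latticeBasis F).ext fun i ↦ by
    rw [latticeBasis_apply, hF, LinearMap.zero_apply]
  funext j
  have := hl (stdBasis F (c j))
  rw [hl0] at this
  simpa [Finsupp.single_apply] using this.symm

/-! ### Generalized upper half spaces -/

/-- `O(n)` as a subgroup of `GL_n(ℝ)`. -/
def orthogonalSubgroup (n : ℕ) : Subgroup (GL (Fin n) ℝ) :=
  (Unitary.toUnits (R := Matrix (Fin n) (Fin n) ℝ)).range

/-- `GL_n(ℤ_p)` as a subgroup of `GL_n(ℚ_p)`. -/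
def integralSubgroup (n : ℕ) (p : Nat.Primes) : Subgroup (GL (Fin n) ℚ_[p]) :=
  (Matrix.GeneralLinearGroup.map (n := Fin n) (algebraMap ℤ_[p] ℚ_[p])).range

/-- `GL_n(ℝ) / ℝˣ O(n)`, with the quotient topology. -/
abbrev HInf (n : ℕ) : Type :=
  GL (Fin n) ℝ ⧸ ((Matrix.GeneralLinearGroup.scalar (R := ℝ) (Fin n)).range ⊔ orthogonalSubgroup n)

/-- `GL_n(ℚ_p) / ℚ_pˣ GL_n(ℤ_p)`, with the quotient topology. -/
abbrev HFin (n : ℕ) (p : Nat.Primes) : Type :=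
  GL (Fin n) ℚ_[p] ⧸
    ((Matrix.GeneralLinearGroup.scalar (R := ℚ_[p]) (Fin n)).range ⊔ integralSubgroup n p)

/-- The generalized upper half space attached to `{∞} ∪ S`, with the product topology. -/
abbrev HS (n : ℕ) (S : Finset Nat.Primes) : Type := HInf n × ∀ p : S, HFin n p

/-- The ring `ℤ[1/N]`, as a subring of `ℚ`, where `N` is the product of the primes in `S`. -/
def ZInv (S : Finset Nat.Primes) : Subring ℚ :=
  Subring.closure {((∏ p ∈ S, (p : ℕ) : ℕ) : ℚ)⁻¹}

/-- The group `SL_n(ℤ[1/N])`. -/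
abbrev GammaS (n : ℕ) (S : Finset Nat.Primes) : Type :=
  Matrix.SpecialLinearGroup (Fin n) (ZInv S)

/-- The map `SL_n(ℤ[1/N]) → GL_n(K)` for a field `K` of characteristic zero. -/
def gammaTo (n : ℕ) (S : Finset Nat.Primes) (K : Type*) [Field K] [CharZero K] :
    GammaS n S →* GL (Fin n) K :=
  Matrix.SpecialLinearGroup.toGL.comp
    (Matrix.SpecialLinearGroup.map ((algebraMap ℚ K).comp (ZInv S).subtype))

/-- `SL_n(ℤ[1/N])` acts on the generalized upper half space by left multiplication on each factor. -/
instance gammaAction (n : ℕ) (S : Finset Nat.Primes) : MulAction (GammaS n S) (HS n S) where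
  smul A x := (gammaTo n S ℝ A • x.1, fun p ↦ gammaTo n S ℚ_[p] A • x.2 p)
  one_smul x := by
    refine Prod.ext ?_ (funext fun p ↦ ?_)
    · change gammaTo n S ℝ 1 • x.1 = x.1
      rw [map_one, one_smul]
    · change gammaTo n S ℚ_[p] 1 • x.2 p = x.2 p
      rw [map_one, one_smul]
  mul_smul A B x := by
    refine Prod.ext ?_ (funext fun p ↦ ?_)
    · change gammaTo n S ℝ (A * B) • x.1 = gammaTo n S ℝ A • gammaTo n S ℝ B • x.1
      rw [map_mul, mul_smul]
    · change gammaTo n S ℚ_[p] (A * B) • x.2 p =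
        gammaTo n S ℚ_[p] A • gammaTo n S ℚ_[p] B • x.2 p
      rw [map_mul, mul_smul]

/-! ### The parameter space -/

/-- `p`, as an element of `ℚˣ`. -/
def primeUnit (p : Nat.Primes) : ℚˣ := Units.mk0 ((p : ℕ) : ℚ) (by exact_mod_cast p.2.ne_zero)

/-- The (discrete) group `p ^ ℤ`. -/
abbrev PrimePow (p : Nat.Primes) : Type := Subgroup.zpowers (primeUnit p)

/-- `(∏_{v ∣ ∞} ℝ_{>0}) × ∏_{p ∈ S} ∏_{v ∣ p} p ^ ℤ`. -/
abbrev TorusS (F : Type*) [Field F] [NumberField F] (S : Finset Nat.Primes) : Type _ :=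
  (InfinitePlace F → {x : ℝ // 0 < x}) × (∀ p : S, PlaceAbove F p → PrimePow p)

/-- The elements `t` with `∏_{v ∣ p} t_v ^ n_v = 1` for `p = ∞` and for every `p ∈ S`. -/
def T1 (F : Type*) [Field F] [NumberField F] (S : Finset Nat.Primes) : Subgroup (TorusS F S) where
  carrier := {t | ∏ v, t.1 v ^ v.mult = 1 ∧
    ∀ p : S, ∏ v : PlaceAbove F p, t.2 p v ^ finrank ℚ_[p] (v.1.adicCompletion F) = 1}
  one_mem' := by simp
  mul_mem' := by
    rintro s t ⟨hs, hs'⟩ ⟨ht, ht'⟩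
    refine ⟨?_, fun p ↦ ?_⟩
    · simp only [Prod.fst_mul, Pi.mul_apply, mul_pow, Finset.prod_mul_distrib, hs, ht, mul_one]
    · simp only [Prod.snd_mul, Pi.mul_apply, mul_pow, Finset.prod_mul_distrib, hs' p, ht' p,
        mul_one]
  inv_mem' := by
    rintro t ⟨ht, ht'⟩
    refine ⟨?_, fun p ↦ ?_⟩
    · simp only [Prod.fst_inv, Pi.inv_apply, inv_pow, Finset.prod_inv_distrib, ht, inv_one]
    · simp only [Prod.snd_inv, Pi.inv_apply, inv_pow, Finset.prod_inv_distrib, ht' p, inv_one]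

/-! ### Heegner objects -/

/-- The auxiliary choices in the definition of a Heegner object: integral coordinates at the places
above `S`, and an ordering of the columns of the matrices (at `∞`: one column for a real place, two
columns, real and imaginary part, for a complex place; at `p`: `n_v` columns for each `v ∣ p`). -/
structure Frame (F : Type*) [Field F] [NumberField F] (S : Finset Nat.Primes) (n : ℕ) where
  infOrder : Fin n ≃ mixedEmbedding.index F
  local_frame : ∀ p : S, LocalFrame F p
  finOrder : ∀ p : S,
    Fin n ≃ Σ v : PlaceAbove F p, Fin (finrank ℚ_[p] (v.1.adicCompletion F))

section

variable {F : Type*} [Field F] [NumberField F] {S : Finset Nat.Primes} {n : ℕ}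

/-- The archimedean place to which a coordinate of `ℝ ^ r₁ × ℂ ^ r₂ = ℝ ^ n` belongs. -/
def indexPlace (F : Type*) [Field F] [NumberField F] : mixedEmbedding.index F → InfinitePlace F :=
  Sum.elim (fun v ↦ v.1) (fun v ↦ v.1.1)

/-- The matrix `(t_1 w^(1) ⋯ t_r w^(r))`. -/
def infMatrix (w : Basis (Fin n) ℚ F) (D : Frame F S n) (t : InfinitePlace F → {x : ℝ // 0 < x}) :
    Matrix (Fin n) (Fin n) ℝ :=
  Matrix.of fun i j ↦ (t (indexPlace F (D.infOrder j)) : ℝ) *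
    (mixedEmbedding.stdBasis F).repr (mixedEmbedding F (w i)) (D.infOrder j)

/-- The matrix `(p ^ e_1 t_1⁻¹ v_1(w) ⋯ p ^ e_g t_g⁻¹ v_g(w))`. -/
def finMatrix (w : Basis (Fin n) ℚ F) (D : Frame F S n) (p : S) (e : PlaceAbove F p → ℤ)
    (t : PlaceAbove F p → PrimePow p) : Matrix (Fin n) (Fin n) ℚ_[p] :=
  Matrix.of fun i j ↦ ((p : ℕ) : ℚ_[p]) ^ e (D.finOrder p j).1 *
    ((((t (D.finOrder p j).1)⁻¹ : PrimePow p) : ℚˣ) : ℚ) *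
    (D.local_frame p).coord (D.finOrder p j) (w i)

theorem infMatrix_det_ne_zero (w : Basis (Fin n) ℚ F) (D : Frame F S n)
    (t : InfinitePlace F → {x : ℝ // 0 < x}) : (infMatrix w D t).det ≠ 0 := by
  have h := Matrix.det_mul_row (fun j ↦ (t (indexPlace F (D.infOrder j)) : ℝ))
    (Matrix.of fun i j ↦ (mixedEmbedding.stdBasis F).repr (mixedEmbedding F (w i)) (D.infOrder j))
  refine ne_of_eq_of_ne h ?_
  refine mul_ne_zero (Finset.prod_ne_zero_iff.2 fun j _ ↦ (t _).2.ne') ?_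
  exact infiniteMatrix_det_ne_zero w D.infOrder

theorem finMatrix_det_ne_zero (w : Basis (Fin n) ℚ F) (D : Frame F S n) (p : S)
    (e : PlaceAbove F p → ℤ) (t : PlaceAbove F p → PrimePow p) : (finMatrix w D p e t).det ≠ 0 := by
  have h := Matrix.det_mul_row (fun j ↦ ((p : ℕ) : ℚ_[p]) ^ e (D.finOrder p j).1 *
    ((((t (D.finOrder p j).1)⁻¹ : PrimePow p) : ℚˣ) : ℚ))
    (Matrix.of fun i j ↦ (D.local_frame p).coord (D.finOrder p j) (w i))
  refine ne_of_eq_of_ne h ?_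
  refine mul_ne_zero (Finset.prod_ne_zero_iff.2 fun j _ ↦ mul_ne_zero (zpow_ne_zero _ ?_) ?_) ?_
  · exact_mod_cast p.1.2.ne_zero
  · exact_mod_cast Units.ne_zero _
  · exact LocalFrame.det_ne_zero w _ (D.finOrder p)

/-- The Heegner object attached to the basis `w` and the indices `e`. -/
def heegner (w : Basis (Fin n) ℚ F) (D : Frame F S n) (e : ∀ p : S, PlaceAbove F p → ℤ)
    (t : T1 F S) : HS n S :=
  (QuotientGroup.mk (Matrix.GeneralLinearGroup.mkOfDetNeZero (infMatrix w D t.1.1)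
      (infMatrix_det_ne_zero w D t.1.1)),
    fun p ↦ QuotientGroup.mk (Matrix.GeneralLinearGroup.mkOfDetNeZero
      (finMatrix w D p (e p) (t.1.2 p)) (finMatrix_det_ne_zero w D p (e p) (t.1.2 p))))

/-- The group of `ρ` for which there is `A ∈ SL_n(ℤ[1/N])` with `A ϖ(t) = ϖ(ρ t)` for all `t`. -/
def periodGroup (w : Basis (Fin n) ℚ F) (D : Frame F S n) (e : ∀ p : S, PlaceAbove F p → ℤ) :
    Subgroup (T1 F S) where
  carrier := {ρ | ∃ A : GammaS n S, ∀ t, A • heegner w D e t = heegner w D e (ρ * t)}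
  one_mem' := ⟨1, fun t ↦ by rw [one_smul, one_mul]⟩
  mul_mem' := by
    rintro ρ σ ⟨A, hA⟩ ⟨B, hB⟩
    exact ⟨A * B, fun t ↦ by rw [mul_smul, hB, hA, mul_assoc]⟩
  inv_mem' := by
    rintro ρ ⟨A, hA⟩
    exact ⟨A⁻¹, fun t ↦ by rw [inv_smul_eq_iff, hA, mul_inv_cancel_left]⟩

/-- The order `{λ ∈ F | A w = λ w for some A ∈ M_n(ℤ[1/N])}`. -/
def multiplierOrder (w : Basis (Fin n) ℚ F) (S : Finset Nat.Primes) : Subring F where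
  carrier := {l | ∃ A : Matrix (Fin n) (Fin n) (ZInv S),
    ((algebraMap ℚ F).comp (ZInv S).subtype).mapMatrix A *ᵥ w = l • ⇑w}
  zero_mem' := ⟨0, by simp⟩
  one_mem' := ⟨1, by rw [map_one, Matrix.one_mulVec, one_smul]⟩
  add_mem' := by
    rintro a b ⟨A, hA⟩ ⟨B, hB⟩
    exact ⟨A + B, by rw [map_add, Matrix.add_mulVec, hA, hB, add_smul]⟩
  neg_mem' := by
    rintro a ⟨A, hA⟩
    exact ⟨-A, by rw [map_neg, Matrix.neg_mulVec, hA, neg_smul]⟩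
  mul_mem' := by
    rintro a b ⟨A, hA⟩ ⟨B, hB⟩
    exact ⟨A * B, by
      rw [map_mul, ← Matrix.mulVec_mulVec, hB, Matrix.mulVec_smul, hA, smul_smul, mul_comm]⟩

/-- The group of units of norm one of the order attached to `w`. -/
def normOneUnits (w : Basis (Fin n) ℚ F) (S : Finset Nat.Primes) : Subgroup Fˣ where
  carrier := {x | (x : F) ∈ multiplierOrder w S ∧ ((x⁻¹ : Fˣ) : F) ∈ multiplierOrder w S ∧
    Algebra.norm ℚ (x : F) = 1}
  one_mem' := by simp [(multiplierOrder w S).one_mem]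
  mul_mem' := by
    rintro x y ⟨h1, h2, h3⟩ ⟨h1', h2', h3'⟩
    refine ⟨?_, ?_, ?_⟩
    · rw [Units.val_mul]
      exact (multiplierOrder w S).mul_mem h1 h1'
    · rw [mul_inv, Units.val_mul]
      exact (multiplierOrder w S).mul_mem h2 h2'
    · rw [Units.val_mul, map_mul, h3, h3', mul_one]
  inv_mem' := by
    rintro x ⟨h1, h2, h3⟩
    refine ⟨h2, by rwa [inv_inv], ?_⟩
    rw [← mul_one (Algebra.norm ℚ ((x⁻¹ : Fˣ) : F)), ← h3, ← map_mul, Units.inv_mul, map_one, h3]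

/-- The map `ε ↦ (|v(ε)|_p)_v`. At a place `v` above an unramified prime `p` the absolute value of
`F_v` with `|p| = 1 / p` is `p ^ (-ord_v)`, and Mathlib's `v`-adic valuation is `exp (-ord_v)`. -/
def absMap (F : Type*) [Field F] [NumberField F] (S : Finset Nat.Primes) : Fˣ →* TorusS F S where
  toFun x := (fun v ↦ ⟨v (x : F), InfinitePlace.pos_iff.2 x.ne_zero⟩,
    fun p v ↦ ⟨primeUnit p ^ WithZero.log (v.1.valuation F (x : F)), _, rfl⟩)
  map_one' := by
    refine Prod.ext (funext fun v ↦ Subtype.ext ?_) (funext fun p ↦ funext fun v ↦ Subtype.ext ?_)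
    · simp
    · simp
  map_mul' x y := by
    refine Prod.ext (funext fun v ↦ Subtype.ext ?_) (funext fun p ↦ funext fun v ↦ Subtype.ext ?_)
    · simp
    · have hx := (Valuation.ne_zero_iff (v.1.valuation F)).2 x.ne_zero
      have hy := (Valuation.ne_zero_iff (v.1.valuation F)).2 y.ne_zero
      simp [WithZero.log_mul hx hy, zpow_add]

/-- The image of the norm one units of the order attached to `w` under the absolute value map. -/
def unitLattice (w : Basis (Fin n) ℚ F) (S : Finset Nat.Primes) : Subgroup (T1 F S) :=
  ((normOneUnits w S).map (absMap F S)).subgroupOf (T1 F S)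

/-! ### Galois action and `χ`-components -/

variable {F' : Type*} [Field F'] [Algebra F' F]

/-- The action of the Galois group on the places above `p`. -/
def galPlace (s : F ≃ₐ[F'] F) {p : Nat.Primes} (v : PlaceAbove F p) : PlaceAbove F p :=
  ⟨HeightOneSpectrum.equivOfRingEquiv (RingOfIntegers.mapRingEquiv s.toRingEquiv) v.1, by
    change (RingOfIntegers.mapRingEquiv s.toRingEquiv).symm ((p : ℕ) : 𝓞 F) ∈ v.1.asIdeal
    rw [map_natCast]
    exact v.2⟩

/-- The action of the Galois group by permutation of the indices: `s(t)_v = t_{s⁻¹ v}`. -/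
def galTorus (s : F ≃ₐ[F'] F) : TorusS F S →* TorusS F S where
  toFun t := (fun v ↦ t.1 (s⁻¹ • v), fun p v ↦ t.2 p (galPlace s⁻¹ v))
  map_one' := rfl
  map_mul' _ _ := rfl

/-- The `χ`-component `{t ∈ M | s(t) = t ^ χ(s) for all s}` of a subgroup `M`. -/
def chiComponent (χ : (F ≃ₐ[F'] F) →* ℤˣ) (M : Subgroup (T1 F S)) : Subgroup (T1 F S) where
  carrier := {t | t ∈ M ∧ ∀ s, galTorus s (t : TorusS F S) = (t : TorusS F S) ^ ((χ s : ℤˣ) : ℤ)}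
  one_mem' := ⟨M.one_mem, fun s ↦ by simp⟩
  mul_mem' := by
    rintro x y ⟨h1, h2⟩ ⟨h1', h2'⟩
    refine ⟨M.mul_mem h1 h1', fun s ↦ ?_⟩
    rw [Subgroup.coe_mul, map_mul, h2, h2', mul_zpow]
  inv_mem' := by
    rintro x ⟨h1, h2⟩
    refine ⟨M.inv_mem h1, fun s ↦ ?_⟩
    rw [Subgroup.coe_inv, map_inv, h2, inv_zpow]

end

end Heegner

end

noncomputable section

namespace Heegner

/-! ### The Galois action on places, valuations and local degrees -/

/-! The Galois group is `{1, s}` with `χ s = -1`, so a χ-component consists of the anti-invariant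
elements, those with `s(t) = t⁻¹`. The product conditions defining T_S^1 are automatic for them: `s`
permutes the places above `p` and preserves local degrees, so each product equals its own inverse,
and neither ℝ_{>0} nor p^ℤ has 2-torsion (`mem_T1_of_galTorus_eq_inv`).

The core is a single cocompactness statement, `exists_isCompact_mul_unitLattice`: up to χ-components
of norm one units, every anti-invariant `t` lies in a fixed compact set. To approximate `t`, choose
an S-unit `x` with log|x|_v close to (log t_v)/(2k) and put ε = (x/s(x))^k. This ε has norm one,
satisfies s(ε) = ε⁻¹, and log|ε|_v = k(log|x|_v - log|x|_{s⁻¹v}) is close to log t_v. At the finite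
places `x` is a product of generators of the principal ideals v^h, with h the class number;
Dirichlet's unit theorem then corrects the archimedean components
(`exists_div_absMap_mem_boundedTorus`). The exponent k forces ε into the multiplier order, which
need not contain every S-unit (`exists_pow_mem_multiplierOrder`).

Norm one units are periods (`unitLattice_le_periodGroup`): if Aw = εw, then A multiplies the column
block of v by the image of ε in F_v. That image is |ε|_v times an orthogonal map at an archimedean
place, and |ε|_v⁻¹ ∈ ℚ_p times a unit of O_v at a place above `p`; the latter needs `p` unramified.
Cocompactness therefore passes to the larger period group. Since periods act through SL_n(ℤ[1/N]),
the image of the whole χ-component is already the continuous image of the compact set. -/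

open MonoidWithZeroHom MonoidWithZeroHom.ValueGroup₀ in
theorem uniformContinuous_withVal_congr {K Γ : Type*} [Field K]
    [LinearOrderedCommGroupWithZero Γ] {v v' : Valuation K Γ} (f : K ≃+* K)
    (h : ∀ x, v' (f x) = v x) : UniformContinuous (WithVal.congr v v' f) := by
  refine uniformContinuous_of_continuousAt_zero _ ?_
  simp_rw [ContinuousAt, map_zero, (Valued.hasBasis_nhds_zero _ _).tendsto_iff
    (Valued.hasBasis_nhds_zero _ _), true_and, forall_const]
  intro γ
  -- A radius in the value group of the target is a ratio of two values; pulling numerator and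
  -- denominator back through `f` gives the radius on the source.
  obtain ⟨r, s, hr₀, hs₀, hr⟩ := Valuation.exists_div_eq_of_unit Valued.v γ
  obtain ⟨r, rfl⟩ := (WithVal.congr v v' f).surjective r
  obtain ⟨s, rfl⟩ := (WithVal.congr v v' f).surjective s
  have key : ∀ x : WithVal v, (Valued.v (WithVal.congr v v' f x) : Γ) = Valued.v x := by
    intro x
    exact h x.ofVal
  have hr₁ : (Valued.v.restrict r) ≠ 0 := by
    rw [Ne, Valuation.zero_iff]
    rintro rfl
    simp at hr₀
  have hs₁ : (Valued.v.restrict s) ≠ 0 := by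
    rw [Ne, Valuation.zero_iff]
    rintro rfl
    simp at hs₀
  refine ⟨Units.mk0 (Valued.v.restrict r / Valued.v.restrict s) (div_ne_zero hr₁ hs₁), ?_⟩
  intro x hx
  have hs₂ : 0 < Valued.v.restrict s := zero_lt_iff.2 hs₁
  have hs₃ : 0 < Valued.v.restrict (WithVal.congr v v' f s) :=
    (Valuation.restrict_pos_iff _ _).2 hs₀
  rw [Units.val_mk0, Set.mem_ofPred_eq, lt_div_iff₀ hs₂, ← map_mul, Valuation.restrict_lt_iff] at hx
  rw [← hr, Set.mem_ofPred_eq, lt_div_iff₀ hs₃, ← map_mul, Valuation.restrict_lt_iff, ← map_mul,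
    key, key]
  exact hx

section

variable {F : Type*} [Field F] [NumberField F] {p : Nat.Primes}

/-- A value-preserving automorphism extends continuously to an injection of completions. It is
ℚ_p-linear because the two embeddings of ℚ_p agree on the dense subfield ℚ. -/
theorem finrank_completion_le (v v' : PlaceAbove F p) (f : F ≃+* F)
    (h : ∀ x, v'.1.valuation F (f x) = v.1.valuation F x)
    [Module.Finite ℚ_[p] (v'.1.adicCompletion F)] :
    finrank ℚ_[p] (v.1.adicCompletion F) ≤ finrank ℚ_[p] (v'.1.adicCompletion F) := by
  let g := (WithVal.congr (v.1.valuation F) (v'.1.valuation F) f).toRingHom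
  have hg : Continuous g := (uniformContinuous_withVal_congr f h).continuous
  let φ : v.1.adicCompletion F →+* v'.1.adicCompletion F :=
    (HeightOneSpectrum.adicCompletion.equiv F v'.1).symm.toRingHom.comp
      ((UniformSpace.Completion.mapRingHom g hg).comp
        (HeightOneSpectrum.adicCompletion.equiv F v.1).toRingHom)
  have hφ : Continuous φ :=
    (HeightOneSpectrum.adicCompletion.uniformEquiv F v'.1).symm.continuous.comp
      ((UniformSpace.Completion.continuous_map).comp
        (HeightOneSpectrum.adicCompletion.uniformEquiv F v.1).continuous)
  have hcomp : ∀ x : ℚ_[p], φ (padicToCompletion v x) = padicToCompletion v' x := by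
    refine fun x ↦ congrFun (DenseRange.equalizer (Padic.denseRange_ratCast p)
      (hφ.comp (padicToCompletion_continuous v)) (padicToCompletion_continuous v') ?_) x
    funext q
    simp
  let φl : v.1.adicCompletion F →ₗ[ℚ_[p]] v'.1.adicCompletion F :=
    { toFun := φ
      map_add' := map_add φ
      map_smul' := fun a x ↦ by
        rw [Algebra.smul_def, Algebra.smul_def, map_mul]
        exact congrArg (· * φ x) (hcomp a) }
  exact LinearMap.finrank_le_finrank_of_injective (f := φl) φ.injective

theorem finrank_completion_eq (v v' : PlaceAbove F p) (f : F ≃+* F)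
    (h : ∀ x, v'.1.valuation F (f x) = v.1.valuation F x)
    [Module.Finite ℚ_[p] (v.1.adicCompletion F)]
    [Module.Finite ℚ_[p] (v'.1.adicCompletion F)] :
    finrank ℚ_[p] (v.1.adicCompletion F) = finrank ℚ_[p] (v'.1.adicCompletion F) :=
  (finrank_completion_le v v' f h).antisymm
    (finrank_completion_le v' v f.symm fun x ↦ by rw [← h, f.apply_symm_apply])

theorem LocalFrame.finite (b : LocalFrame F p) (v : PlaceAbove F p) :
    Module.Finite ℚ_[p] (v.1.adicCompletion F) := .of_basis (b.basis v)

variable {F' : Type*} [Field F'] [Algebra F' F]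

/-- The automorphism carries powers of the prime ideal of `v` onto powers of that of `s v`, and
membership in these powers determines the valuation. -/
theorem valuation_galPlace (s : F ≃ₐ[F'] F) (v : PlaceAbove F p) (x : F) :
    (galPlace s v).1.valuation F (s x) = v.1.valuation F x := by
  let e := RingOfIntegers.mapRingEquiv s.toRingEquiv
  have hint : ∀ a : 𝓞 F, (galPlace s v).1.intValuation (e a) = v.1.intValuation a := by
    intro a
    have key : ∀ n : ℕ, e a ∈ (galPlace s v).1.asIdeal ^ n ↔ a ∈ v.1.asIdeal ^ n := by
      intro n
      have h1 : (galPlace s v).1.asIdeal = v.1.asIdeal.map e := by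
        change v.1.asIdeal.comap (e.symm : 𝓞 F →+* 𝓞 F) = _
        exact Ideal.comap_symm e
      rw [h1, ← Ideal.map_pow, Ideal.mem_map_of_equiv]
      simp
    rcases eq_or_ne a 0 with rfl | ha
    · simp
    have hv : ∀ u : HeightOneSpectrum (𝓞 F), ∀ b : 𝓞 F, b ≠ 0 →
        ∃ m : ℕ, u.intValuation b = WithZero.exp (-(m : ℤ)) := fun u b hb ↦
      ⟨_, u.intValuation_if_neg hb⟩
    obtain ⟨m, hm⟩ := hv v.1 a ha
    obtain ⟨m', hm'⟩ := hv (galPlace s v).1 (e a) (by simpa using ha)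
    have h1 := (key m).2 ((v.1.intValuation_le_pow_iff_mem a m).1 hm.le)
    have h2 := (key m').1 (((galPlace s v).1.intValuation_le_pow_iff_mem (e a) m').1 hm'.le)
    rw [← HeightOneSpectrum.intValuation_le_pow_iff_mem] at h1 h2
    rw [hm'] at h1
    rw [hm] at h2
    rw [hm, hm']
    exact le_antisymm h1 h2
  obtain ⟨a, b, hb, rfl⟩ := IsFractionRing.div_surjective (A := 𝓞 F) x
  have he : ∀ a : 𝓞 F, s (algebraMap (𝓞 F) F a) = algebraMap (𝓞 F) F (e a) := fun _ ↦ rfl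
  rw [map_div₀, map_div₀, map_div₀, he, he, HeightOneSpectrum.valuation_of_algebraMap,
    HeightOneSpectrum.valuation_of_algebraMap, HeightOneSpectrum.valuation_of_algebraMap,
    HeightOneSpectrum.valuation_of_algebraMap, hint, hint]

theorem galPlace_one (v : PlaceAbove F p) : galPlace (1 : F ≃ₐ[F'] F) v = v := by
  refine Subtype.ext (HeightOneSpectrum.ext ?_)
  ext a
  rfl

theorem galPlace_mul (s t : F ≃ₐ[F'] F) (v : PlaceAbove F p) :
    galPlace (s * t) v = galPlace s (galPlace t v) := by
  refine Subtype.ext (HeightOneSpectrum.ext ?_)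
  ext a
  rfl

theorem valuation_galPlace_inv (s : F ≃ₐ[F'] F) (v : PlaceAbove F p) (x : F) :
    (galPlace s⁻¹ v).1.valuation F x = v.1.valuation F (s x) := by
  rw [← valuation_galPlace s⁻¹ v (s x)]
  congr 1
  exact (s.symm_apply_apply x).symm

theorem primeUnit_zpow_injective (p : Nat.Primes) :
    Function.Injective fun k : ℤ ↦ primeUnit p ^ k := by
  intro a b h
  have h1 : ((p : ℕ) : ℚ) ^ a = ((p : ℕ) : ℚ) ^ b := by
    simpa [primeUnit] using congrArg Units.val h
  exact zpow_right_injective₀ (by exact_mod_cast p.2.pos) (by exact_mod_cast p.2.ne_one) h1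

theorem primePow_eq_one_of_sq {x : PrimePow p} (h : x ^ 2 = 1) : x = 1 := by
  obtain ⟨_, k, rfl⟩ := x
  have h1 : primeUnit p ^ (k * 2) = primeUnit p ^ (0 : ℤ) := by
    rw [zpow_mul, zpow_zero]
    exact congrArg Subtype.val h
  have h2 : k * 2 = 0 := primeUnit_zpow_injective p h1
  obtain rfl : k = 0 := by omega
  exact Subtype.ext (zpow_zero _)

end

/-! ### Powers of `S`-units in the multiplier order -/

section

variable {F : Type*} [Field F] [NumberField F] {n : ℕ}

theorem intCast_mem_ZInv (S : Finset Nat.Primes) (z : ℤ) : (z : ℚ) ∈ ZInv S :=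
  intCast_mem _ z

theorem inv_prod_mem_ZInv (S : Finset Nat.Primes) :
    ((∏ p ∈ S, (p : ℕ) : ℕ) : ℚ)⁻¹ ∈ ZInv S :=
  Subring.subset_closure rfl

theorem inv_prime_mem_ZInv {S : Finset Nat.Primes} {p : Nat.Primes} (hp : p ∈ S) :
    ((p : ℕ) : ℚ)⁻¹ ∈ ZInv S := by
  classical
  have h1 : ((p : ℕ) : ℚ)⁻¹ =
      ((∏ q ∈ S, (q : ℕ) : ℕ) : ℚ)⁻¹ * ((∏ q ∈ S.erase p, (q : ℕ) : ℕ) : ℚ) := by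
    have h2 : ((∏ q ∈ S.erase p, (q : ℕ) : ℕ) : ℚ) ≠ 0 := by
      exact_mod_cast Finset.prod_ne_zero_iff.2 fun (q : Nat.Primes) _ ↦ q.2.ne_zero
    rw [← Finset.mul_prod_erase S _ hp, Nat.cast_mul, mul_inv, mul_assoc, inv_mul_cancel₀ h2,
      mul_one]
  rw [h1]
  exact (ZInv S).mul_mem (inv_prod_mem_ZInv S) (natCast_mem _ _)

/-- The only possible matrix is that of multiplication by `l` in the basis `w`, so membership is a
condition on its entries. -/
theorem mem_multiplierOrder_iff (w : Basis (Fin n) ℚ F) (S : Finset Nat.Primes) (l : F) :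
    l ∈ multiplierOrder w S ↔ ∀ i j, w.repr (l * w i) j ∈ ZInv S := by
  constructor
  · rintro ⟨A, hA⟩ i j
    have h1 : l * w i = ∑ j, (A i j : ℚ) • w j := by
      have h2 := congrFun hA i
      simp only [Matrix.mulVec, dotProduct, RingHom.mapMatrix_apply, Matrix.map_apply,
        RingHom.comp_apply, Subring.coe_subtype, Pi.smul_apply, smul_eq_mul] at h2
      rw [← h2]
      exact Finset.sum_congr rfl fun j _ ↦ (Algebra.smul_def _ _).symm
    rw [h1, w.repr_sum_self]
    exact (A i j).2
  · intro h
    refine ⟨Matrix.of fun i j ↦ ⟨w.repr (l * w i) j, h i j⟩, funext fun i ↦ ?_⟩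
    simp only [Matrix.mulVec, dotProduct, RingHom.mapMatrix_apply, Matrix.map_apply,
      RingHom.comp_apply, Subring.coe_subtype, Pi.smul_apply, smul_eq_mul, Matrix.of_apply]
    conv_rhs => rw [← w.sum_repr (l * w i)]
    exact Finset.sum_congr rfl fun j _ ↦ (Algebra.smul_def _ _).symm

theorem algebraMap_mem_multiplierOrder (w : Basis (Fin n) ℚ F) {S : Finset Nat.Primes} {q : ℚ}
    (hq : q ∈ ZInv S) : algebraMap ℚ F q ∈ multiplierOrder w S := by
  rw [mem_multiplierOrder_iff]
  intro i j
  rw [← Algebra.smul_def, map_smul, w.repr_self, Finsupp.smul_apply, Finsupp.single_apply,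
    smul_eq_mul]
  split_ifs
  · rwa [mul_one]
  · rw [mul_zero]
    exact (ZInv S).zero_mem

theorem exists_natCast_mul_mem_multiplierOrder (w : Basis (Fin n) ℚ F) (S : Finset Nat.Primes)
    (l : F) : ∃ d : ℕ, 0 < d ∧ (d : F) * l ∈ multiplierOrder w S := by
  refine ⟨∏ i, ∏ j, (w.repr (l * w i) j).den, Finset.prod_pos fun i _ ↦ Finset.prod_pos fun j _ ↦
    Rat.den_pos _, ?_⟩
  rw [mem_multiplierOrder_iff]
  intro i j
  have h1 : (w.repr (l * w i) j).den ∣ ∏ i, ∏ j, (w.repr (l * w i) j).den :=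
    (Finset.dvd_prod_of_mem (fun j ↦ (w.repr (l * w i) j).den) (Finset.mem_univ j)).trans
      (Finset.dvd_prod_of_mem (fun i ↦ ∏ j, (w.repr (l * w i) j).den) (Finset.mem_univ i))
  obtain ⟨c, hc⟩ := h1
  rw [hc, mul_assoc, ← nsmul_eq_mul, map_nsmul, Finsupp.smul_apply, nsmul_eq_mul]
  rw [Nat.cast_mul, mul_comm ((w.repr (l * w i) j).den : ℚ), mul_assoc, mul_comm _ (w.repr _ j),
    Rat.mul_den_eq_num]
  exact (ZInv S).mul_mem (natCast_mem _ _) (intCast_mem_ZInv S _)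

/-- One denominator serves all integers because the ring of integers has a finite ℤ-basis. -/
theorem exists_natCast_mul_integer_mem_multiplierOrder (w : Basis (Fin n) ℚ F)
    (S : Finset Nat.Primes) : ∃ d : ℕ, 0 < d ∧
      ∀ a : 𝓞 F, (d : F) * algebraMap (𝓞 F) F a ∈ multiplierOrder w S := by
  let b := RingOfIntegers.basis F
  choose d hd hd' using fun j ↦
    exists_natCast_mul_mem_multiplierOrder w S (algebraMap (𝓞 F) F (b j))
  refine ⟨∏ j, d j, Finset.prod_pos fun j _ ↦ hd j, fun a ↦ ?_⟩
  rw [← b.sum_repr a, map_sum, Finset.mul_sum]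
  refine (multiplierOrder w S).sum_mem fun j _ ↦ ?_
  obtain ⟨c, hc⟩ := Finset.dvd_prod_of_mem d (Finset.mem_univ j)
  rw [hc, zsmul_eq_mul, map_mul, map_intCast, Nat.cast_mul,
    show (d j : F) * (c : F) * ((b.repr a j : F) * algebraMap (𝓞 F) F (b j)) =
      (c : F) * (b.repr a j : F) * ((d j : F) * algebraMap (𝓞 F) F (b j)) by ring]
  exact (multiplierOrder w S).mul_mem
    ((multiplierOrder w S).mul_mem (natCast_mem _ _) (intCast_mem _ _)) (hd' j)

theorem exists_coprime_mul_integer_mem_multiplierOrder (w : Basis (Fin n) ℚ F)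
    (S : Finset Nat.Primes) : ∃ d : ℕ, 0 < d ∧ (∀ p ∈ S, ¬ (p : ℕ) ∣ d) ∧
      ∀ a : 𝓞 F, (d : F) * algebraMap (𝓞 F) F a ∈ multiplierOrder w S := by
  classical
  have hex := exists_natCast_mul_integer_mem_multiplierOrder w S
  obtain ⟨h1, h2⟩ := Nat.find_spec hex
  -- The least admissible `d` is prime to `S`: a factor `p ∈ S` could be cancelled, since `1/p` lies
  -- in the order.
  refine ⟨Nat.find hex, h1, fun p hp ⟨c, hc⟩ ↦ ?_, h2⟩
  have hc0 : 0 < c := by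
    rcases Nat.eq_zero_or_pos c with rfl | h
    · rw [hc, mul_zero] at h1
      exact h1
    · exact h
  refine Nat.find_min hex (m := c) ?_ ⟨hc0, fun a ↦ ?_⟩
  · rw [hc]
    exact lt_mul_of_one_lt_left hc0 p.2.one_lt
  · have hp0 : ((p : ℕ) : F) ≠ 0 := by exact_mod_cast p.2.ne_zero
    have h3 := (multiplierOrder w S).mul_mem
      (algebraMap_mem_multiplierOrder w (inv_prime_mem_ZInv hp)) (h2 a)
    rwa [hc, Nat.cast_mul, map_inv₀, map_natCast, mul_assoc, inv_mul_cancel_left₀ hp0] at h3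

/-- The group of `S`-units of `F`. -/
def sUnits (F : Type*) [Field F] [NumberField F] (S : Finset Nat.Primes) : Subgroup Fˣ where
  carrier := {x | ∃ m : ℕ, IsIntegral ℤ (((∏ p ∈ S, (p : ℕ) : ℕ) : F) ^ m * (x : F)) ∧
    IsIntegral ℤ (((∏ p ∈ S, (p : ℕ) : ℕ) : F) ^ m * ((x⁻¹ : Fˣ) : F))}
  one_mem' := ⟨0, by simpa using isIntegral_one, by simpa using isIntegral_one⟩
  mul_mem' := by
    rintro x y ⟨m, h1, h2⟩ ⟨m', h1', h2'⟩
    refine ⟨m + m', ?_, ?_⟩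
    · rw [Units.val_mul, pow_add, mul_mul_mul_comm]
      exact h1.mul h1'
    · rw [mul_inv, Units.val_mul, pow_add, mul_mul_mul_comm]
      exact h2.mul h2'
  inv_mem' := by
    rintro x ⟨m, h1, h2⟩
    exact ⟨m, h2, by rwa [inv_inv]⟩

theorem unit_mem_sUnits (S : Finset Nat.Primes) (u : (𝓞 F)ˣ) :
    Units.map (algebraMap (𝓞 F) F : 𝓞 F →* F) u ∈ sUnits F S := by
  refine ⟨0, ?_, ?_⟩
  · rw [pow_zero, one_mul]
    exact (u : 𝓞 F).isIntegral_coe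
  · rw [pow_zero, one_mul, ← map_inv]
    exact ((u⁻¹ : (𝓞 F)ˣ) : 𝓞 F).isIntegral_coe

theorem map_mem_sUnits {F' : Type*} [Field F'] [Algebra F' F] (s : F ≃ₐ[F'] F)
    {S : Finset Nat.Primes} {x : Fˣ} (hx : x ∈ sUnits F S) :
    Units.map (s : F →* F) x ∈ sUnits F S := by
  obtain ⟨m, h1, h2⟩ := hx
  refine ⟨m, ?_, ?_⟩
  · simpa using map_isIntegral_int (s : F →+* F) h1
  · simpa using map_isIntegral_int (s : F →+* F) h2

/-- N lies in the prime ideal of `v`, so N^h lies in its `h`-th power and the generator `a` divides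
N^h. -/
theorem generator_mem_sUnits {S : Finset Nat.Primes} {p : Nat.Primes} (hp : p ∈ S)
    (v : PlaceAbove F p) {h : ℕ} {a : 𝓞 F} (ha : v.1.asIdeal ^ h = Ideal.span {a}) (x : Fˣ)
    (hx : (x : F) = algebraMap (𝓞 F) F a) : x ∈ sUnits F S := by
  have h1 : ((∏ p ∈ S, (p : ℕ) : ℕ) : 𝓞 F) ∈ v.1.asIdeal := by
    rw [Nat.cast_prod]
    exact Ideal.prod_mem _ hp v.2
  have h2 := Ideal.pow_mem_pow h1 h
  rw [ha, Ideal.mem_span_singleton] at h2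
  obtain ⟨c, hc⟩ := h2
  refine ⟨h, ?_, ?_⟩
  · rw [hx, ← map_natCast (algebraMap (𝓞 F) F), ← map_pow, ← map_mul]
    exact RingOfIntegers.isIntegral_coe _
  · have h3 : (((∏ p ∈ S, (p : ℕ) : ℕ) : F) ^ h * ((x⁻¹ : Fˣ) : F)) = algebraMap (𝓞 F) F c := by
      rw [← map_natCast (algebraMap (𝓞 F) F), ← map_pow, hc, map_mul, ← hx, Units.val_inv_eq_inv_val,
        mul_comm (x : F), mul_assoc, mul_inv_cancel₀ x.ne_zero, mul_one]
    rw [h3]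
    exact RingOfIntegers.isIntegral_coe _

/-- Take `d` prime to N with d·O_F inside the order. After multiplication by a power of N, an S-unit
becomes an integer invertible modulo `d`; its power with exponent the order of (O_F/d)ˣ is 1 modulo
`d`, hence in the order. The power of N is removed by `1/N`, which the order contains. -/
theorem exists_pow_mem_multiplierOrder (w : Basis (Fin n) ℚ F) (S : Finset Nat.Primes) :
    ∃ k : ℕ, 0 < k ∧ ∀ x ∈ sUnits F S, ((x ^ k : Fˣ) : F) ∈ multiplierOrder w S := by
  classical
  obtain ⟨d, hd, hdS, hdM⟩ := exists_coprime_mul_integer_mem_multiplierOrder w S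
  set N : ℕ := ∏ p ∈ S, (p : ℕ) with hN
  have hN0 : (N : F) ≠ 0 := by
    exact_mod_cast Finset.prod_ne_zero_iff.2 fun (q : Nat.Primes) _ ↦ q.2.ne_zero
  let I : Ideal (𝓞 F) := Ideal.span {(d : 𝓞 F)}
  have hI : I ≠ ⊥ := by
    rw [Ne, Ideal.span_singleton_eq_bot]
    exact_mod_cast hd.ne'
  have : Finite (𝓞 F ⧸ I) := Ideal.finiteQuotientOfFreeOfNeBot I hI
  have : Fintype (𝓞 F ⧸ I)ˣ := Fintype.ofFinite _
  have hNI : IsUnit ((N : ℕ) : 𝓞 F ⧸ I) := by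
    have hcop : Nat.Coprime N d := Nat.Coprime.prod_left fun p hp ↦
      (Nat.Prime.coprime_iff_not_dvd p.2).2 (hdS p hp)
    have h1 : IsCoprime ((N : ℕ) : 𝓞 F ⧸ I) ((d : ℕ) : 𝓞 F ⧸ I) := by
      have := (Nat.isCoprime_iff_coprime.2 hcop).map (Int.castRingHom (𝓞 F ⧸ I))
      simpa using this
    have h2 : ((d : ℕ) : 𝓞 F ⧸ I) = 0 := by
      rw [← map_natCast (Ideal.Quotient.mk I)]
      exact Ideal.Quotient.eq_zero_iff_mem.2 (Ideal.mem_span_singleton_self _)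
    rwa [h2, isCoprime_zero_right] at h1
  have key : ∀ (a b : 𝓞 F) (m : ℕ), a * b = (N : 𝓞 F) ^ m →
      (algebraMap (𝓞 F) F a) ^ Fintype.card (𝓞 F ⧸ I)ˣ ∈ multiplierOrder w S := by
    intro a b m hab
    have hu : IsUnit (Ideal.Quotient.mk I a) := by
      refine isUnit_of_mul_isUnit_left (y := Ideal.Quotient.mk I b) ?_
      rw [← map_mul, hab, map_pow, map_natCast]
      exact hNI.pow m
    obtain ⟨u, hu⟩ := hu
    have h1 : Ideal.Quotient.mk I (a ^ Fintype.card (𝓞 F ⧸ I)ˣ) = Ideal.Quotient.mk I 1 := by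
      rw [map_pow, ← hu, ← Units.val_pow_eq_pow_val, pow_card_eq_one, Units.val_one, map_one]
    rw [Ideal.Quotient.eq, Ideal.mem_span_singleton] at h1
    obtain ⟨c, hc⟩ := h1
    have h2 : (algebraMap (𝓞 F) F a) ^ Fintype.card (𝓞 F ⧸ I)ˣ =
        1 + (d : F) * algebraMap (𝓞 F) F c := by
      rw [← map_pow, sub_eq_iff_eq_add.1 hc, map_add, map_mul, map_natCast, map_one, add_comm]
    rw [h2]
    exact (multiplierOrder w S).add_mem (multiplierOrder w S).one_mem (hdM c)
  refine ⟨Fintype.card (𝓞 F ⧸ I)ˣ, Fintype.card_pos, ?_⟩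
  rintro x ⟨m, h1, h2⟩
  obtain ⟨a, ha⟩ := IsIntegralClosure.isIntegral_iff (A := 𝓞 F).1 h1
  obtain ⟨b, hb⟩ := IsIntegralClosure.isIntegral_iff (A := 𝓞 F).1 h2
  have hab : a * b = (N : 𝓞 F) ^ (m + m) := by
    apply FaithfulSMul.algebraMap_injective (𝓞 F) F
    rw [map_mul, ha, hb, map_pow, map_natCast, mul_mul_mul_comm, ← Units.val_mul, mul_inv_cancel,
      Units.val_one, mul_one, pow_add]
  have h3 := key a b _ hab
  have h4 : (N : F)⁻¹ ∈ multiplierOrder w S := by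
    have := algebraMap_mem_multiplierOrder w (inv_prod_mem_ZInv S)
    rwa [map_inv₀, map_natCast] at this
  have h5 := (multiplierOrder w S).mul_mem (Subring.pow_mem _ h4 (m * Fintype.card (𝓞 F ⧸ I)ˣ)) h3
  rw [ha, mul_pow, ← pow_mul, inv_pow, inv_mul_cancel_left₀ (pow_ne_zero _ hN0)] at h5
  rwa [Units.val_pow_eq_pow_val]

end

/-! ### Unit theorems -/

section

variable {F : Type*} [Field F] [NumberField F]

/-- Dirichlet's theorem in cocompact form: the logarithms of units are a full lattice in the
trace-zero space, so rounding to the lattice leaves a bounded error. -/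
theorem exists_unit_log_sub_le (F : Type*) [Field F] [NumberField F] :
    ∃ C : ℝ, ∀ f : InfinitePlace F → ℝ, ∑ v, (v.mult : ℝ) * f v = 0 →
      ∃ u : (𝓞 F)ˣ, ∀ v : InfinitePlace F, |Real.log (v (u : F)) - f v| ≤ C := by
  classical
  let b := (Units.basisUnitLattice F).ofZLatticeBasis ℝ (Units.unitLattice F)
  let B : ℝ := ∑ i, ‖b i‖
  have hB : 0 ≤ B := Finset.sum_nonneg fun i _ ↦ norm_nonneg _
  let r : ℝ := Fintype.card {v : InfinitePlace F // v ≠ Units.dirichletUnitTheorem.w₀}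
  have hr : 0 ≤ r := Nat.cast_nonneg _
  -- `B` bounds the fractional part in each coordinate of the log space. The coordinate at the
  -- omitted place `w₀` is minus the sum of the `r` others, which costs `r * B`.
  refine ⟨B + r * B, fun f hf ↦ ?_⟩
  let g : Units.dirichletUnitTheorem.logSpace F := fun v ↦ (v.1.mult : ℝ) * f v.1
  have hfl : (ZSpan.floor b g : Units.dirichletUnitTheorem.logSpace F) ∈ Units.unitLattice F := by
    exact (Basis.ofZLatticeBasis_span ℝ _ (Units.basisUnitLattice F)).le (ZSpan.floor b g).2
  obtain ⟨u, -, hu⟩ := hfl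
  have hbound : ∀ v, |g v - Units.logEmbedding F u v| ≤ B := by
    intro v
    have h := ZSpan.norm_fract_le b g
    rw [ZSpan.fract_apply] at h
    refine le_trans ?_ h
    have h' := norm_le_pi_norm (g - (ZSpan.floor b g : Units.dirichletUnitTheorem.logSpace F)) v
    rw [← hu] at h'
    rw [← hu]
    exact h'
  have habs : ∀ (v : InfinitePlace F) (y c : ℝ), |(v.mult : ℝ) * y| ≤ c → |y| ≤ c := by
    intro v y c h
    rw [abs_mul, Nat.abs_cast] at h
    refine le_trans ?_ h
    have : (1 : ℝ) ≤ v.mult := by exact_mod_cast v.mult_pos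
    nlinarith [abs_nonneg y]
  refine ⟨u.toMul, fun v ↦ ?_⟩
  by_cases hv : v = Units.dirichletUnitTheorem.w₀
  · subst hv
    have h1 := Units.dirichletUnitTheorem.sum_logEmbedding_component u.toMul
    rw [Fintype.sum_eq_add_sum_subtype_ne _ Units.dirichletUnitTheorem.w₀] at hf
    have h2 : (Units.dirichletUnitTheorem.w₀ (K := F)).mult *
        (Real.log (Units.dirichletUnitTheorem.w₀ ((u.toMul : (𝓞 F)ˣ) : F)) -
          f Units.dirichletUnitTheorem.w₀) = ∑ v, (g v - Units.logEmbedding F u v) := by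
      rw [Finset.sum_sub_distrib]
      change ∑ v, Units.logEmbedding F u v = _ at h1
      rw [h1]
      linarith
    refine habs Units.dirichletUnitTheorem.w₀ _ _ ?_
    rw [h2]
    refine (Finset.abs_sum_le_sum_abs _ _).trans ?_
    refine (Finset.sum_le_sum fun v _ ↦ hbound v).trans ?_
    rw [Finset.sum_const, nsmul_eq_mul, Finset.card_univ]
    exact le_add_of_nonneg_left hB
  · refine (habs v _ _ ?_).trans (le_add_of_nonneg_right (mul_nonneg hr hB))
    rw [mul_sub, abs_sub_comm]
    exact hbound ⟨v, hv⟩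

/-- The class group is annihilated by its order. -/
theorem exists_generator_pow_classNumber (v : HeightOneSpectrum (𝓞 F)) :
    ∃ a : 𝓞 F, a ≠ 0 ∧ v.asIdeal ^ classNumber F = Ideal.span {a} := by
  have hv : v.asIdeal ∈ nonZeroDivisors (Ideal (𝓞 F)) := mem_nonZeroDivisors_of_ne_zero v.ne_bot
  have h1 : ClassGroup.mk0 (⟨v.asIdeal, hv⟩ ^ classNumber F) = 1 := by
    rw [map_pow]
    exact pow_card_eq_one
  rw [SubmonoidClass.mk_pow, ClassGroup.mk0_eq_one_iff] at h1
  obtain ⟨a, ha⟩ := h1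
  refine ⟨a, ?_, ha⟩
  rintro rfl
  exact pow_ne_zero (classNumber F) v.ne_bot (by simpa using ha)

theorem valuation_generator_self {v : HeightOneSpectrum (𝓞 F)} {a : 𝓞 F} {h : ℕ} (ha : a ≠ 0)
    (hva : v.asIdeal ^ h = Ideal.span {a}) :
    WithZero.log (v.valuation F (algebraMap (𝓞 F) F a)) = -(h : ℤ) := by
  obtain ⟨m, hm⟩ : ∃ m : ℕ, v.intValuation a = WithZero.exp (-(m : ℤ)) :=
    ⟨_, v.intValuation_if_neg ha⟩
  -- Both sides say that the `l`-th power of the prime divides (a).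
  have key : ∀ l : ℕ, l ≤ m ↔ l ≤ h := by
    intro l
    have h1 := v.intValuation_le_pow_iff_dvd a l
    rw [hm, ← hva, WithZero.exp_le_exp, neg_le_neg_iff, Nat.cast_le, pow_dvd_pow_iff v.ne_bot] at h1
    · exact h1
    · rw [Ideal.isUnit_iff]
      exact v.isPrime.ne_top
  have hmh : m = h := le_antisymm ((key m).1 le_rfl) ((key h).2 le_rfl)
  rw [HeightOneSpectrum.valuation_of_algebraMap, hm, WithZero.log_exp, hmh]

theorem valuation_generator_of_ne {v v' : HeightOneSpectrum (𝓞 F)} {a : 𝓞 F} {h : ℕ}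
    (hva : v.asIdeal ^ h = Ideal.span {a}) (hvv' : v' ≠ v) :
    WithZero.log (v'.valuation F (algebraMap (𝓞 F) F a)) = 0 := by
  have h1 : v'.intValuation a = 1 := by
    rw [HeightOneSpectrum.intValuation_eq_one_iff]
    intro hmem
    apply hvv'
    have h2 : v.asIdeal ^ h ≤ v'.asIdeal := by
      rw [hva, Ideal.span_le]
      simpa using hmem
    have h3 := Ideal.IsPrime.le_of_pow_le (hP := v'.isPrime) h2
    exact HeightOneSpectrum.ext (v.isMaximal.eq_of_le v'.isPrime.ne_top h3).symm
  rw [HeightOneSpectrum.valuation_of_algebraMap, h1, WithZero.log_one]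

theorem placeAbove_val_ne {p q : Nat.Primes} (hpq : p ≠ q) (v : PlaceAbove F p)
    (v' : PlaceAbove F q) : v.1 ≠ v'.1 := by
  intro h
  have hcop : IsCoprime ((p : ℕ) : 𝓞 F) ((q : ℕ) : 𝓞 F) := by
    have := (Nat.isCoprime_iff_coprime.2 ((Nat.coprime_primes p.2 q.2).2
      fun h ↦ hpq (Subtype.ext h))).map (Int.castRingHom (𝓞 F))
    simpa using this
  obtain ⟨a, b, hab⟩ := hcop
  apply v.1.isPrime.ne_top
  rw [Ideal.eq_top_iff_one, ← hab]
  exact Ideal.add_mem _ (Ideal.mul_mem_left _ _ v.2) (Ideal.mul_mem_left _ _ (h ▸ v'.2))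

end

/-! ### The anti-invariant part of the torus -/

theorem mult_smul {F' F : Type*} [Field F'] [Field F] [Algebra F' F] (s : F ≃ₐ[F'] F) (v : InfinitePlace F) : (s • v).mult = v.mult := by
  have h := InfinitePlace.isReal_smul_iff (σ := s) (w := v)
  by_cases hv : v.IsReal
  · simp [InfinitePlace.mult, h.2 hv, hv]
  · simp [InfinitePlace.mult, mt h.1 hv, hv]

section

variable {F' F : Type*} [Field F'] [Field F] [NumberField F] [Algebra F' F] {S : Finset Nat.Primes}

/-- Equivariance of the absolute value map: |x| at `s⁻¹ v` equals |s x| at `v`. -/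
theorem galTorus_absMap (s : F ≃ₐ[F'] F) (x : Fˣ) :
    galTorus s (absMap F S x) = absMap F S (Units.map (s : F →* F) x) := by
  refine Prod.ext (funext fun v ↦ Subtype.ext ?_) (funext fun p ↦ funext fun v ↦ Subtype.ext ?_)
  · rfl
  · change primeUnit p ^ WithZero.log ((galPlace s⁻¹ v).1.valuation F (x : F)) =
      primeUnit p ^ WithZero.log (v.1.valuation F (s (x : F)))
    rw [valuation_galPlace_inv]

/-- Reindexing the defining product by `s` turns it into its inverse. The local frames supply the
finiteness of F_v over ℚ_p needed to compare local degrees. As a result the anti-invariant part of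
T_S^1 is a closed subset of the full torus. -/
theorem mem_T1_of_galTorus_eq_inv (D : ∀ p : S, LocalFrame F p) (s : F ≃ₐ[F'] F)
    {t : TorusS F S} (ht : galTorus s t = t⁻¹) : t ∈ T1 F S := by
  constructor
  · let y : {x : ℝ // 0 < x} := ∏ v, t.1 v ^ v.mult
    have h1 : y = y⁻¹ := by
      calc y = ∏ v, t.1 (s⁻¹ • v) ^ (s⁻¹ • v).mult :=
            (Equiv.prod_comp (MulAction.toPerm s⁻¹) fun v ↦ t.1 v ^ v.mult).symm
        _ = ∏ v, (t.1 v)⁻¹ ^ v.mult := Finset.prod_congr rfl fun v _ ↦ by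
            have h2 : t.1 (s⁻¹ • v) = (t.1 v)⁻¹ := congrFun (congrArg Prod.fst ht) v
            rw [h2, mult_smul]
        _ = y⁻¹ := by simp [y, Finset.prod_inv_distrib]
    have h2 : (y : ℝ) * y = 1 := by
      have := eq_inv_iff_mul_eq_one.1 h1
      exact congrArg Subtype.val this
    refine Subtype.ext ?_
    have h3 := y.2
    change (y : ℝ) = 1
    nlinarith
  · intro p
    let n : PlaceAbove F p → ℕ := fun v ↦ finrank ℚ_[p] (v.1.adicCompletion F)
    let y : PrimePow p := ∏ v, t.2 p v ^ n v
    let e : PlaceAbove F p ≃ PlaceAbove F p :=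
      { toFun := galPlace s⁻¹
        invFun := galPlace s
        left_inv := fun v ↦ by rw [← galPlace_mul, mul_inv_cancel, galPlace_one]
        right_inv := fun v ↦ by rw [← galPlace_mul, inv_mul_cancel, galPlace_one] }
    have h1 : y = y⁻¹ := by
      calc y = ∏ v, t.2 p (e v) ^ n (e v) :=
            (Equiv.prod_comp e fun v ↦ t.2 p v ^ n v).symm
        _ = ∏ v, (t.2 p v)⁻¹ ^ n v := Finset.prod_congr rfl fun v _ ↦ by
            have h2 : t.2 p (e v) = (t.2 p v)⁻¹ := congrFun (congrFun (congrArg Prod.snd ht) p) v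
            have h3 : n (e v) = n v := by
              have := (D p).finite v
              have := (D p).finite (e v)
              refine (finrank_completion_eq v (e v) (s⁻¹ : F ≃ₐ[F'] F).toRingEquiv fun x ↦ ?_).symm
              exact valuation_galPlace s⁻¹ v x
            rw [h2, h3]
        _ = y⁻¹ := by simp [y, Finset.prod_inv_distrib]
    refine primePow_eq_one_of_sq (x := y) ?_
    rw [pow_two]
    exact eq_inv_iff_mul_eq_one.1 h1

end

/-- The homomorphism `x ↦ x / s(x)`. -/
def divGal {F' F : Type*} [Field F'] [Field F] [Algebra F' F] (s : F ≃ₐ[F'] F) : Fˣ →* Fˣ := MonoidHom.id Fˣ / Units.map (s : F →* F)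

theorem divGal_apply {F' F : Type*} [Field F'] [Field F] [Algebra F' F] (s : F ≃ₐ[F'] F) (x : Fˣ) : divGal s x = x / Units.map (s : F →* F) x := rfl

/-! ### Approximating anti-invariant elements by quotients x/s(x) -/

section

variable {F' F : Type*} [Field F'] [Field F] [NumberField F] [Algebra F' F] {S : Finset Nat.Primes}

theorem map_divGal {F' F : Type*} [Field F'] [Field F] [Algebra F' F] {s : F ≃ₐ[F'] F} (hs : s * s = 1) (x : Fˣ) :
    Units.map (s : F →* F) (divGal s x) = (divGal s x)⁻¹ := by
  have h : Units.map (s : F →* F) (Units.map (s : F →* F) x) = x :=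
    Units.ext (DFunLike.congr_fun hs (x : F))
  rw [divGal_apply, map_div, h, inv_div]

theorem norm_divGal [NumberField F'] (s : F ≃ₐ[F'] F) (x : Fˣ) :
    Algebra.norm ℚ ((divGal s x : Fˣ) : F) = 1 := by
  have h : Algebra.norm ℚ (s (x : F)) = Algebra.norm ℚ (x : F) :=
    Algebra.norm_eq_of_algEquiv (s.restrictScalars ℚ) (x : F)
  have h1 : (divGal s x : F) * s (x : F) = x := by
    rw [divGal_apply, Units.val_div_eq_div_val]
    exact div_mul_cancel₀ _ (Units.ne_zero (Units.map (s : F →* F) x))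
  refine mul_right_cancel₀ (Algebra.norm_ne_zero_iff.2 x.ne_zero) ?_
  rw [one_mul, ← h, ← map_mul, h1, h]

theorem galTorus_absMap_divGal {s : F ≃ₐ[F'] F} (hs : s * s = 1) (x : Fˣ) (k : ℕ) :
    galTorus s (absMap F S (divGal s x ^ k)) = (absMap F S (divGal s x ^ k))⁻¹ := by
  rw [galTorus_absMap, map_pow, map_divGal hs, inv_pow, map_inv]

theorem divGal_mem_sUnits (s : F ≃ₐ[F'] F) {x : Fˣ} (hx : x ∈ sUnits F S) :
    divGal s x ∈ sUnits F S :=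
  (sUnits F S).div_mem hx (map_mem_sUnits s hx)

/-- Membership in the order is needed for the power and for its inverse; both are `k`-th powers of
S-units. -/
theorem divGal_pow_mem_normOneUnits [NumberField F'] {n : ℕ} (w : Basis (Fin n) ℚ F)
    (s : F ≃ₐ[F'] F) {k : ℕ}
    (hk : ∀ x ∈ sUnits F S, ((x ^ k : Fˣ) : F) ∈ multiplierOrder w S) {x : Fˣ}
    (hx : x ∈ sUnits F S) : divGal s x ^ k ∈ normOneUnits w S := by
  have h1 := divGal_mem_sUnits s hx
  refine ⟨hk _ h1, ?_, ?_⟩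
  · rw [← inv_pow]
    exact hk _ ((sUnits F S).inv_mem h1)
  · rw [Units.val_pow_eq_pow_val, map_pow, norm_divGal, one_pow]

/-- The elements of the torus whose components are bounded, on the logarithmic scale, by `C`. -/
def boundedTorus (F : Type*) [Field F] [NumberField F] (S : Finset Nat.Primes) (C : ℝ) :
    Set (TorusS F S) :=
  {t | (∀ v, |Real.log (t.1 v)| ≤ C) ∧
    ∀ p v, ∃ k : ℤ, |(k : ℝ)| ≤ C ∧ (t.2 p v : ℚˣ) = primeUnit p ^ k}

theorem absMap_snd_val (x : Fˣ) (p : S) (v : PlaceAbove F p) :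
    (((absMap F S x).2 p v : PrimePow p) : ℚˣ) =
      primeUnit p ^ WithZero.log (v.1.valuation F (x : F)) := rfl

theorem log_valuation_mul (v : HeightOneSpectrum (𝓞 F)) (x y : Fˣ) :
    WithZero.log (v.valuation F ((x * y : Fˣ) : F)) =
      WithZero.log (v.valuation F (x : F)) + WithZero.log (v.valuation F (y : F)) := by
  rw [Units.val_mul, map_mul]
  exact WithZero.log_mul ((Valuation.ne_zero_iff _).2 x.ne_zero)
    ((Valuation.ne_zero_iff _).2 y.ne_zero)

/-- The logarithm of the valuation at `v`, as a homomorphism. -/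
def logVal (v : HeightOneSpectrum (𝓞 F)) : Fˣ →* Multiplicative ℤ where
  toFun x := Multiplicative.ofAdd (WithZero.log (v.valuation F (x : F)))
  map_one' := by simp
  map_mul' x y := by rw [log_valuation_mul, ofAdd_add]

/-- The valuations above `S` can be prescribed freely among multiples of the class number: multiply
generators of the principal powers of the individual primes. -/
theorem exists_sUnit_log_valuation (b : ∀ p : S, PlaceAbove F p → ℤ) :
    ∃ x ∈ sUnits F S, ∀ (p : S) (v : PlaceAbove F p),
      WithZero.log (v.1.valuation F (x : F)) = -((classNumber F : ℤ) * b p v) := by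
  classical
  choose a ha0 ha using exists_generator_pow_classNumber (F := F)
  let α : HeightOneSpectrum (𝓞 F) → Fˣ := fun v ↦ Units.mk0 (algebraMap (𝓞 F) F (a v))
    (by simpa using ha0 v)
  refine ⟨∏ s : Σ p : S, PlaceAbove F p, α s.2.1 ^ b s.1 s.2, ?_, fun p v ↦ ?_⟩
  · exact Subgroup.prod_mem _ fun s _ ↦ Subgroup.zpow_mem _
      (generator_mem_sUnits s.1.2 s.2 (ha _) (α s.2.1) rfl) _
  · change (logVal v.1 _).toAdd = _
    rw [map_prod, toAdd_prod, Finset.sum_eq_single ⟨p, v⟩]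
    · rw [map_zpow, toAdd_zpow]
      change b p v • WithZero.log (v.1.valuation F (algebraMap (𝓞 F) F (a v.1))) = _
      rw [valuation_generator_self (ha0 _) (ha _), smul_eq_mul]
      ring
    · rintro ⟨q, u⟩ - hne
      rw [map_zpow, toAdd_zpow]
      change b q u • WithZero.log (v.1.valuation F (algebraMap (𝓞 F) F (a u.1))) = _
      rw [valuation_generator_of_ne (ha _), smul_zero]
      intro h
      apply hne
      by_cases hpq : p = q
      · subst hpq
        rw [Subtype.ext h]
      · exact absurd h (placeAbove_val_ne (fun h' ↦ hpq (Subtype.ext h')) v u)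
    · intro h
      exact absurd (Finset.mem_univ _) h

theorem log_valuation_divGal_pow (s : F ≃ₐ[F'] F) (x : Fˣ) (k : ℕ) {p : Nat.Primes}
    (v : PlaceAbove F p) :
    WithZero.log (v.1.valuation F ((divGal s x ^ k : Fˣ) : F)) =
      k * (WithZero.log (v.1.valuation F (x : F)) -
        WithZero.log ((galPlace s⁻¹ v).1.valuation F (x : F))) := by
  change (logVal v.1 _).toAdd = _
  rw [map_pow, toAdd_pow, divGal_apply, map_div, toAdd_div, valuation_galPlace_inv, nsmul_eq_mul]
  rfl

theorem log_infinitePlace_divGal_pow {F' F : Type*} [Field F'] [Field F] [Algebra F' F]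
    (s : F ≃ₐ[F'] F) (x : Fˣ) (k : ℕ) (v : InfinitePlace F) :
    Real.log (v ((divGal s x ^ k : Fˣ) : F)) =
      k * (Real.log (v (x : F)) - Real.log ((s⁻¹ • v) (x : F))) := by
  rw [Units.val_pow_eq_pow_val, map_pow, Real.log_pow, divGal_apply, Units.val_div_eq_div_val,
    map_div₀, Real.log_div (InfinitePlace.pos_iff.2 x.ne_zero).ne'
      (InfinitePlace.pos_iff.2 (Units.ne_zero _)).ne']
  rfl

/-- The approximation step: `x = x₁ * x₂`, where `x₁` handles the finite places and the unit `x₂`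
repairs the archimedean ones without changing any finite valuation. -/
theorem exists_div_absMap_mem_boundedTorus (s : F ≃ₐ[F'] F) (hs : s * s = 1)
    {k : ℕ} (hk : 0 < k) : ∃ C : ℝ, ∀ t : TorusS F S, galTorus s t = t⁻¹ →
      ∃ x ∈ sUnits F S, t / absMap F S (divGal s x ^ k) ∈ boundedTorus F S C := by
  obtain ⟨C₀, hC₀⟩ := exists_unit_log_sub_le F
  set h : ℕ := classNumber F with hh
  have hpos : 0 < h := Fintype.card_pos
  have hk' : (0 : ℝ) < k := by exact_mod_cast hk
  -- At infinity the Dirichlet error `C₀` enters at `v` and at `s⁻¹ v`, each multiplied by `k`. At a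
  -- finite place the error is `k * h` times the difference of two fractional parts in [0, 1).
  refine ⟨max (2 * k * C₀) (h * k), fun t ht ↦ ?_⟩
  have hfin : ∀ (p : S) (v : PlaceAbove F p), ∃ a : ℤ, (t.2 p v : ℚˣ) = primeUnit p ^ a := by
    intro p v
    obtain ⟨a, ha⟩ := (t.2 p v).2
    exact ⟨a, ha.symm⟩
  choose a ha using hfin
  have hanti : ∀ (p : S) (v : PlaceAbove F p), a p (galPlace s⁻¹ v) = -a p v := by
    intro p v
    apply primeUnit_zpow_injective p
    have h1 : t.2 p (galPlace s⁻¹ v) = (t.2 p v)⁻¹ := congrFun (congrFun (congrArg Prod.snd ht) p) v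
    change primeUnit p ^ _ = primeUnit p ^ _
    rw [← ha, h1, zpow_neg, ← ha]
    rfl
  -- The target is log val(x₁) ≈ a/(2k), halved because `x₁` and `s(x₁)` contribute equally. As the
  -- attainable values are `-h * b`, this means rounding `-a/(2hk)` down.
  obtain ⟨x₁, hx₁, hval⟩ := exists_sUnit_log_valuation
    (fun (p : S) (v : PlaceAbove F p) ↦ (-a p v) / (2 * h * k : ℤ))
  set t' : TorusS F S := t / absMap F S (divGal s x₁ ^ k) with ht'
  have ht'' : galTorus s t' = t'⁻¹ := by
    rw [ht', map_div, galTorus_absMap_divGal hs, ht, inv_div_inv, inv_div]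
  let f : InfinitePlace F → ℝ := fun v ↦ Real.log (t'.1 v) / (2 * k)
  have hf : ∀ v, f (s⁻¹ • v) = -f v := by
    intro v
    have h1 : t'.1 (s⁻¹ • v) = (t'.1 v)⁻¹ := congrFun (congrArg Prod.fst ht'') v
    have h2 : ((t'.1 (s⁻¹ • v) : {x : ℝ // 0 < x}) : ℝ) = (t'.1 v : ℝ)⁻¹ := congrArg Subtype.val h1
    simp only [f]
    rw [h2, Real.log_inv, neg_div]
  -- Anti-invariance makes the weighted sum its own negative, which is the trace-zero condition
  -- required by the unit theorem.
  have hsum : ∑ v : InfinitePlace F, (v.mult : ℝ) * f v = 0 := by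
    have h1 : ∑ v : InfinitePlace F, (v.mult : ℝ) * f v = -∑ v : InfinitePlace F, (v.mult : ℝ) * f v := by
      calc _ = ∑ v : InfinitePlace F, ((s⁻¹ • v).mult : ℝ) * f (s⁻¹ • v) :=
            (Equiv.sum_comp (MulAction.toPerm s⁻¹) fun v : InfinitePlace F ↦ (v.mult : ℝ) * f v).symm
        _ = ∑ v : InfinitePlace F, -((v.mult : ℝ) * f v) := Finset.sum_congr rfl fun v _ ↦ by
            rw [hf, mult_smul, mul_neg]
        _ = _ := Finset.sum_neg_distrib _
    linarith
  obtain ⟨u, hu⟩ := hC₀ f hsum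
  let x₂ : Fˣ := Units.map (algebraMap (𝓞 F) F : 𝓞 F →* F) u
  have hquot : t / absMap F S (divGal s (x₁ * x₂) ^ k) = t' / absMap F S (divGal s x₂ ^ k) := by
    rw [ht', map_mul, mul_pow, map_mul, div_div]
  refine ⟨x₁ * x₂, (sUnits F S).mul_mem hx₁ (unit_mem_sUnits S u), ?_⟩
  constructor
  · intro v
    refine le_trans ?_ (le_max_left _ _)
    rw [hquot]
    have h1 : (((t' / absMap F S (divGal s x₂ ^ k)).1 v : {x : ℝ // 0 < x}) : ℝ) =
        (t'.1 v : ℝ) / v ((divGal s x₂ ^ k : Fˣ) : F) := by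
      rw [Prod.fst_div, Pi.div_apply, div_eq_mul_inv, Positive.val_mul, Positive.coe_inv,
        ← div_eq_mul_inv]
      rfl
    have h2 : Real.log (t'.1 v) = 2 * k * f v := by
      simp only [f]
      field_simp
    rw [h1, Real.log_div (t'.1 v).2.ne' (InfinitePlace.pos_iff.2 (Units.ne_zero _)).ne',
      log_infinitePlace_divGal_pow, h2]
    have h3 := abs_le.1 (hu v)
    have h4 := abs_le.1 (hu (s⁻¹ • v))
    rw [hf] at h4
    have hx : (x₂ : F) = algebraMap (𝓞 F) F u := rfl
    rw [hx, abs_le]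
    constructor <;> nlinarith
  · intro p v
    refine ⟨a p v - WithZero.log (v.1.valuation F ((divGal s (x₁ * x₂) ^ k : Fˣ) : F)), ?_, ?_⟩
    · refine le_trans ?_ (le_max_right _ _)
      have h1 : ∀ u' : HeightOneSpectrum (𝓞 F), WithZero.log (u'.valuation F (x₂ : F)) = 0 := by
        intro u'
        have h2 : u'.valuation F (x₂ : F) = 1 := by
          change u'.valuation F (algebraMap (𝓞 F) F u) = 1
          rw [HeightOneSpectrum.valuation_eq_one_iff_notMem]
          intro hmem
          exact u'.isPrime.ne_top (Ideal.eq_top_of_isUnit_mem _ hmem u.isUnit)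
        rw [h2, WithZero.log_one]
      rw [log_valuation_divGal_pow, log_valuation_mul, log_valuation_mul, h1, h1, hval, hval,
        hanti, neg_neg]
      have hc : (0 : ℤ) < 2 * h * k := by positivity
      -- The values at `v` and `s⁻¹ v` come from rounding `-a` and `a` separately; the total error
      -- is half the difference of the two remainders, each in [0, 2hk).
      have e1 := Int.mul_ediv_add_emod (-a p v) (2 * h * k)
      have e2 := Int.mul_ediv_add_emod (a p v) (2 * h * k)
      have e3 := Int.emod_nonneg (-a p v) hc.ne'
      have e4 := Int.emod_nonneg (a p v) hc.ne'
      have e5 := Int.emod_lt_of_pos (-a p v) hc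
      have e6 := Int.emod_lt_of_pos (a p v) hc
      generalize -a p v / (2 * h * k : ℤ) = A at *
      generalize a p v / (2 * h * k : ℤ) = B at *
      have : |a p v - k * (-(h * A) + 0 - (-(h * B) + 0))| ≤ (h * k : ℤ) := by
        rw [abs_le]
        constructor <;> nlinarith
      exact_mod_cast this
    · rw [Prod.snd_div, Pi.div_apply, Pi.div_apply, Subgroup.coe_div, ha, absMap_snd_val, zpow_sub,
        div_eq_mul_inv]

end

/-! ### Norm one units are periods -/

/-- Matrices of scaled coordinates of a basis, multiplied by the matrix `A` of multiplication by `ε`: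
the effect is to scale the coordinates by `l` and to multiply by the matrix `U` of `ε / l`. -/
theorem mul_of_scaled_coord {F : Type*} [Field F] {n : ℕ} {K : Type*} [Field K] (A U : Matrix (Fin n) (Fin n) K)
    (coord : Fin n → F → K) (w : Fin n → F) (ε : F) (l τ : Fin n → K)
    (hA : ∀ i j, coord j (ε * w i) = ∑ m, A i m * coord j (w m))
    (hU : ∀ i j, coord j (ε * w i) = ∑ m, coord m (w i) * (l j * U m j))
    (hdiag : ∀ m j, U m j ≠ 0 → l m = l j ∧ τ m = τ j) :
    A * Matrix.of (fun i j ↦ τ j * coord j (w i)) =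
      Matrix.of (fun i j ↦ (l j * τ j) * coord j (w i)) * U := by
  ext i j
  simp only [Matrix.mul_apply, Matrix.of_apply]
  calc ∑ m, A i m * (τ j * coord j (w m)) = τ j * coord j (ε * w i) := by
        rw [hA, Finset.mul_sum]
        exact Finset.sum_congr rfl fun m _ ↦ by ring
    _ = _ := by
        rw [hU, Finset.mul_sum]
        refine Finset.sum_congr rfl fun m _ ↦ ?_
        -- Nonzero entries of `U` only link coordinates with equal scalars (in practice, coordinates
        -- of the same place), so the diagonal scaling commutes with `U`.
        by_cases h : U m j = 0
        · rw [h]; ring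
        · rw [(hdiag m j h).1, (hdiag m j h).2]; ring

/-! ### Unramified valuations and the archimedean component -/

section

variable {F : Type*} [Field F] [NumberField F]

/-- Being unramified excludes `p` from the square of the prime, so `p` is a uniformizer at `v`. -/
theorem valuation_prime_of_isUnramifiedAt {p : Nat.Primes} (v : PlaceAbove F p)
    [Algebra.IsUnramifiedAt ℤ v.1.asIdeal] :
    v.1.valuation F ((p : ℕ) : F) = WithZero.exp (-1 : ℤ) := by
  have hp0 : ((p : ℕ) : 𝓞 F) ≠ 0 := by exact_mod_cast p.2.ne_zero
  obtain ⟨m, hm⟩ : ∃ m : ℕ, v.1.intValuation ((p : ℕ) : 𝓞 F) = WithZero.exp (-(m : ℤ)) :=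
    ⟨_, v.1.intValuation_if_neg hp0⟩
  have h1 : 1 ≤ m := by
    have h := (v.1.intValuation_le_pow_iff_mem ((p : ℕ) : 𝓞 F) 1).2 (by simpa using v.2)
    rw [hm, WithZero.exp_le_exp] at h
    omega
  have h2 : ¬ 2 ≤ m := by
    intro h
    have h3 : ((p : ℕ) : 𝓞 F) ∈ v.1.asIdeal ^ 2 := by
      rw [← HeightOneSpectrum.intValuation_le_pow_iff_mem, hm, WithZero.exp_le_exp]
      omega
    have h4 : v.1.asIdeal.under ℤ = Ideal.span {((p : ℕ) : ℤ)} := by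
      have hmax : (Ideal.span {((p : ℕ) : ℤ)}).IsMaximal :=
        PrincipalIdealRing.isMaximal_of_irreducible (Nat.prime_iff_prime_int.1 p.2).irreducible
      refine (hmax.eq_of_le (Ideal.IsPrime.under ℤ v.1.asIdeal).ne_top ?_).symm
      rw [Ideal.span_singleton_le_iff_mem, Ideal.mem_comap]
      simpa using v.2
    let := Localization.AtPrime.algebraOfLiesOver (v.1.asIdeal.under ℤ) v.1.asIdeal
    have h5 : Ideal.ramificationIdx' (v.1.asIdeal.under ℤ) v.1.asIdeal = 1 :=
      (Ideal.IsDedekindDomain.ramificationIdx'_eq_one_iff v.1.ne_bot Ideal.map_comap_le).2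
        ((Algebra.isUnramifiedAt_iff_map_eq ℤ (v.1.asIdeal.under ℤ) v.1.asIdeal).1 inferInstance).2
    rw [h4] at h5
    refine absurd h5 ((Ideal.ramificationIdx'_ne_one_iff (h4 ▸ Ideal.map_comap_le)).2 ?_)
    rw [Ideal.map_span, Set.image_singleton, Ideal.span_singleton_le_iff_mem]
    simpa using h3
  obtain rfl : m = 1 := by omega
  rw [← map_natCast (algebraMap (𝓞 F) F), HeightOneSpectrum.valuation_of_algebraMap, hm]
  rfl

open Classical mixedEmbedding in
theorem sum_stdBasis_repr_mul (x y : mixedSpace F) :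
    ∑ j, (stdBasis F).repr x j * (stdBasis F).repr y j =
      ∑ v, x.1 v * y.1 v + ∑ v, ((x.2 v).re * (y.2 v).re + (x.2 v).im * (y.2 v).im) := by
  rw [Fintype.sum_sum_type, Fintype.sum_prod_type]
  simp [Fin.sum_univ_two]

/-- The vector `(v(ε) / |v(ε)|)_v`. -/
def phase (ε : F) : mixedEmbedding.mixedSpace F :=
  (fun v ↦ (mixedEmbedding F ε).1 v / v.1 ε, fun v ↦ (mixedEmbedding F ε).2 v / ((v.1 ε : ℝ) : ℂ))

open Classical mixedEmbedding in
-- Multiplication by a sign or by a complex number of modulus one preserves the Euclidean inner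
-- product, place by place.
theorem sum_stdBasis_repr_phase_mul {ε : F} (hε : ε ≠ 0) (x y : mixedSpace F) :
    ∑ j, (stdBasis F).repr (phase ε * x) j * (stdBasis F).repr (phase ε * y) j =
      ∑ j, (stdBasis F).repr x j * (stdBasis F).repr y j := by
  rw [sum_stdBasis_repr_mul, sum_stdBasis_repr_mul]
  congr 1
  · refine Finset.sum_congr rfl fun v _ ↦ ?_
    have h1 : ((phase ε).1 v) ^ 2 = 1 := by
      have h2 : ‖(mixedEmbedding F ε).1 v‖ = v.1 ε := by
        rw [mixedEmbedding_apply_isReal, InfinitePlace.norm_embedding_of_isReal]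
      change ((mixedEmbedding F ε).1 v / v.1 ε) ^ 2 = 1
      rw [div_pow, ← h2, Real.norm_eq_abs, sq_abs, div_self]
      refine pow_ne_zero 2 (norm_ne_zero_iff.1 ?_)
      rw [h2]
      exact (InfinitePlace.pos_iff.2 hε).ne'
    change ((phase ε).1 v * x.1 v) * ((phase ε).1 v * y.1 v) = _
    linear_combination x.1 v * y.1 v * h1
  · refine Finset.sum_congr rfl fun v _ ↦ ?_
    have h1 : ((phase ε).2 v).re ^ 2 + ((phase ε).2 v).im ^ 2 = 1 := by
      have h2 : ‖(mixedEmbedding F ε).2 v‖ = v.1 ε := by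
        rw [mixedEmbedding_apply_isComplex, InfinitePlace.norm_embedding_eq]
      have h3 : ‖(phase ε).2 v‖ = 1 := by
        change ‖(mixedEmbedding F ε).2 v / ((v.1 ε : ℝ) : ℂ)‖ = 1
        rw [norm_div, h2, Complex.norm_real, Real.norm_of_nonneg (apply_nonneg _ _), div_self]
        exact (InfinitePlace.pos_iff.2 hε).ne'
      have h4 := Complex.normSq_eq_norm_sq ((phase ε).2 v)
      rw [h3, Complex.normSq_apply] at h4
      linarith
    change ((phase ε).2 v * x.2 v).re * ((phase ε).2 v * y.2 v).re +
      ((phase ε).2 v * x.2 v).im * ((phase ε).2 v * y.2 v).im = _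
    simp only [Complex.mul_re, Complex.mul_im]
    linear_combination ((x.2 v).re * (y.2 v).re + (x.2 v).im * (y.2 v).im) * h1

open Classical mixedEmbedding in
theorem stdBasis_repr_mixedEmbedding_mul {ε : F} (hε : ε ≠ 0) (z : mixedSpace F) (j : index F) :
    (stdBasis F).repr (mixedEmbedding F ε * z) j =
      indexPlace F j ε * (stdBasis F).repr (phase ε * z) j := by
  rcases j with v | ⟨v, i⟩
  · have hv : v.1 ε ≠ 0 := (InfinitePlace.pos_iff.2 hε).ne'
    change (mixedEmbedding F ε).1 v * z.1 v = v.1 ε * ((mixedEmbedding F ε).1 v / v.1 ε * z.1 v)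
    field_simp
  · have hv : v.1 ε ≠ 0 := (InfinitePlace.pos_iff.2 hε).ne'
    have hv' : ((v.1 ε : ℝ) : ℂ) ≠ 0 := by exact_mod_cast hv
    have h1 : (mixedEmbedding F ε).2 v * z.2 v = ((v.1 ε : ℝ) : ℂ) * ((phase ε).2 v * z.2 v) := by
      change _ = ((v.1 ε : ℝ) : ℂ) * ((mixedEmbedding F ε).2 v / ((v.1 ε : ℝ) : ℂ) * z.2 v)
      field_simp
    fin_cases i
    · change ((mixedEmbedding F ε).2 v * z.2 v).re = v.1 ε * ((phase ε).2 v * z.2 v).re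
      rw [h1, Complex.re_ofReal_mul]
    · change ((mixedEmbedding F ε).2 v * z.2 v).im = v.1 ε * ((phase ε).2 v * z.2 v).im
      rw [h1, Complex.im_ofReal_mul]

open Classical mixedEmbedding in
-- Multiplication acts place by place, so its matrix in the standard basis is block diagonal.
theorem stdBasis_repr_mul_stdBasis_eq_zero (x : mixedSpace F) {m j : index F}
    (h : indexPlace F m ≠ indexPlace F j) : (stdBasis F).repr (x * stdBasis F m) j = 0 := by
  have hz : ∀ j', indexPlace F j' = indexPlace F j → (stdBasis F).repr (stdBasis F m) j' = 0 := by
    intro j' hj'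
    rw [Basis.repr_self, Finsupp.single_eq_of_ne]
    rintro rfl
    exact h hj'
  generalize stdBasis F m = z at hz
  rcases j with v | ⟨v, i⟩
  · have h0 : z.1 v = 0 := hz (Sum.inl v) rfl
    change x.1 v * z.1 v = 0
    rw [h0, mul_zero]
  · have h0 : z.2 v = 0 := Complex.ext (hz (Sum.inr (v, 0)) rfl) (hz (Sum.inr (v, 1)) rfl)
    have h1 : x.2 v * z.2 v = 0 := by rw [h0, mul_zero]
    fin_cases i
    · change (x.2 v * z.2 v).re = 0
      rw [h1, Complex.zero_re]
    · change (x.2 v * z.2 v).im = 0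
      rw [h1, Complex.zero_im]

variable {S : Finset Nat.Primes} {n : ℕ}

open Classical mixedEmbedding in
theorem exists_orthogonal_mul_infMatrix (w : Basis (Fin n) ℚ F) (D : Frame F S n) (ε : Fˣ)
    (A : Matrix (Fin n) (Fin n) ℝ) (hA : ∀ i m, A i m = (w.repr ((ε : F) * w i) m : ℝ)) :
    ∃ U : Matrix (Fin n) (Fin n) ℝ, U * Uᵀ = 1 ∧ ∀ t : InfinitePlace F → {x : ℝ // 0 < x},
      A * infMatrix w D t = infMatrix w D ((absMap F S ε).1 * t) * U := by
  -- Row `m` holds the coordinates of the phase of ε times the `m`-th basis vector, so `U * Uᵀ` is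
  -- the Gram matrix of the rotated orthonormal basis.
  let U : Matrix (Fin n) (Fin n) ℝ := Matrix.of fun m j ↦
    (stdBasis F).repr (phase (ε : F) * stdBasis F (D.infOrder m)) (D.infOrder j)
  refine ⟨U, ?_, fun t ↦ ?_⟩
  · ext m m'
    rw [Matrix.mul_apply]
    simp only [Matrix.transpose_apply, U, Matrix.of_apply]
    rw [Equiv.sum_comp D.infOrder fun j ↦
      (stdBasis F).repr (phase (ε : F) * stdBasis F (D.infOrder m)) j *
        (stdBasis F).repr (phase (ε : F) * stdBasis F (D.infOrder m')) j,
      sum_stdBasis_repr_phase_mul ε.ne_zero]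
    simp [Finsupp.single_apply, Matrix.one_apply, eq_comm]
  · refine mul_of_scaled_coord A U
      (fun j a ↦ (stdBasis F).repr (mixedEmbedding F a) (D.infOrder j)) w ε
      (fun j ↦ indexPlace F (D.infOrder j) (ε : F)) (fun j ↦ t (indexPlace F (D.infOrder j)))
      ?_ ?_ ?_
    · intro i j
      conv_lhs => rw [← w.sum_repr ((ε : F) * w i)]
      rw [map_sum, map_sum, Finsupp.finsetSum_apply]
      refine Finset.sum_congr rfl fun m _ ↦ ?_
      rw [map_rat_smul, ← Rat.cast_smul_eq_qsmul ℝ, map_smul, hA, Finsupp.smul_apply, smul_eq_mul]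
    · intro i j
      simp only [U, Matrix.of_apply]
      rw [map_mul]
      conv_lhs => rw [← (stdBasis F).sum_repr (mixedEmbedding F (w i))]
      rw [Finset.mul_sum, map_sum, Finsupp.finsetSum_apply,
        ← Equiv.sum_comp D.infOrder]
      refine Finset.sum_congr rfl fun m _ ↦ ?_
      rw [mul_smul_comm, map_smul, Finsupp.smul_apply, smul_eq_mul,
        stdBasis_repr_mixedEmbedding_mul ε.ne_zero]
    · intro m j h
      have h1 : indexPlace F (D.infOrder m) = indexPlace F (D.infOrder j) := by
        by_contra h1
        exact h (stdBasis_repr_mul_stdBasis_eq_zero _ h1)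
      simp only [h1, and_self]

end

/-! ### The p-adic components and the inclusion of units in periods -/

section

variable {F : Type*} [Field F] [NumberField F]

theorem LocalFrame.norm_repr_le_one {p : Nat.Primes} (b : LocalFrame F p) (v : PlaceAbove F p)
    {x : v.1.adicCompletion F} (hx : Valued.v x ≤ 1)
    (k : Fin (finrank ℚ_[p] (v.1.adicCompletion F))) : ‖(b.basis v).repr x k‖ ≤ 1 :=
  (b.integral v x).1 hx k

theorem LocalFrame.valued_basis_le_one {p : Nat.Primes} (b : LocalFrame F p) (v : PlaceAbove F p)
    (k : Fin (finrank ℚ_[p] (v.1.adicCompletion F))) : Valued.v (b.basis v k) ≤ 1 := by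
  classical
  refine (b.integral v _).2 fun k' ↦ ?_
  rw [Basis.repr_self, Finsupp.single_apply]
  split_ifs <;> simp

variable {S : Finset Nat.Primes} {n : ℕ}

/-- The image of the component of `absMap` at `v` in `ℚ_p`. -/
def padicAbs (p : Nat.Primes) (v : PlaceAbove F p) (x : F) : ℚ_[p] :=
  ((p : ℕ) : ℚ_[p]) ^ (-WithZero.log (v.1.valuation F x))

theorem padicAbs_ne_zero (p : Nat.Primes) (v : PlaceAbove F p) (x : F) : padicAbs p v x ≠ 0 :=
  zpow_ne_zero _ (by exact_mod_cast p.2.ne_zero)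

/-- With `p` a uniformizer at `v`, this power of `p` has the same valuation as `x`; its exponent is
ord_v(x). It is the inverse of the component of `absMap`, matching the factor t_v⁻¹ in the finite
matrices. -/
theorem valued_algebraMap_padicAbs {p : Nat.Primes} (v : PlaceAbove F p)
    [Algebra.IsUnramifiedAt ℤ v.1.asIdeal] (x : Fˣ) :
    Valued.v (algebraMap ℚ_[p] (v.1.adicCompletion F) (padicAbs p v x)) =
      v.1.valuation F (x : F) := by
  have hx := (Valuation.ne_zero_iff (v.1.valuation F)).2 x.ne_zero
  rw [padicAbs, map_zpow₀, map_natCast, ← map_natCast (algebraMap F (v.1.adicCompletion F)),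
    map_zpow₀, valued_algebraMap, valuation_prime_of_isUnramifiedAt, ← WithZero.exp_zsmul]
  simp [WithZero.exp_log hx]

theorem exists_integral_mul_finMatrix (w : Basis (Fin n) ℚ F) (D : Frame F S n) (p : S)
    (e : PlaceAbove F p → ℤ) (hS : ∀ v : PlaceAbove F p, Algebra.IsUnramifiedAt ℤ v.1.asIdeal)
    (ε : Fˣ) (A : Matrix (Fin n) (Fin n) ℚ_[p])
    (hA : ∀ i m, A i m = (w.repr ((ε : F) * w i) m : ℚ_[p])) :
    ∃ U : Matrix (Fin n) (Fin n) ℚ_[p], (∀ i j, ‖U i j‖ ≤ 1) ∧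
      ∀ t : PlaceAbove F p → PrimePow p,
        A * finMatrix w D p e t = finMatrix w D p e ((absMap F S ε).2 p * t) * U := by
  classical
  let b := D.local_frame p
  -- The unit part of ε at `v`. It preserves O_v, so its matrix in an integral basis has entries in
  -- ℤ_p.
  let η : ∀ v : PlaceAbove F p, v.1.adicCompletion F := fun v ↦
    algebraMap F _ (ε : F) * algebraMap ℚ_[p] _ (padicAbs p v (ε : F))⁻¹
  have hη : ∀ v, Valued.v (η v) = 1 := by
    intro v
    have := hS v
    simp only [η]
    rw [map_mul, map_inv₀, map_inv₀, valued_algebraMap, valued_algebraMap_padicAbs,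
      mul_inv_cancel₀ ((Valuation.ne_zero_iff _).2 ε.ne_zero)]
  have hη' : ∀ v (x : v.1.adicCompletion F),
      algebraMap F _ (ε : F) * x = padicAbs p v (ε : F) • (η v * x) := by
    intro v x
    have h1 : algebraMap ℚ_[p] (v.1.adicCompletion F) (padicAbs p v (ε : F)) *
        algebraMap ℚ_[p] (v.1.adicCompletion F) (padicAbs p v (ε : F))⁻¹ = 1 := by
      rw [← map_mul, mul_inv_cancel₀ (padicAbs_ne_zero p v _), map_one]
    rw [Algebra.smul_def]
    linear_combination (-(algebraMap F (v.1.adicCompletion F) (ε : F)) * x) * h1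
  -- The block diagonal matrix of multiplication by `η`. `Pi.single` places a basis vector in the
  -- product of all F_v, which avoids transport along equalities of places.
  let V : (Σ v : PlaceAbove F p, Fin (finrank ℚ_[p] (v.1.adicCompletion F))) →
      (Σ v : PlaceAbove F p, Fin (finrank ℚ_[p] (v.1.adicCompletion F))) → ℚ_[p] := fun s s' ↦
    (b.basis s'.1).repr (η s'.1 * (Pi.single s.1 (b.basis s.1 s.2) :
      ∀ v : PlaceAbove F p, v.1.adicCompletion F) s'.1) s'.2
  have hV0 : ∀ s s', s'.1 ≠ s.1 → V s s' = 0 := by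
    intro s s' h
    simp only [V]
    rw [Pi.single_eq_of_ne h, mul_zero, map_zero, Finsupp.zero_apply]
  have hV1 : ∀ v k k', V ⟨v, k⟩ ⟨v, k'⟩ = (b.basis v).repr (η v * b.basis v k) k' := by
    intro v k k'
    simp only [V]
    rw [Pi.single_eq_same]
  refine ⟨Matrix.of fun m j ↦ V (D.finOrder p m) (D.finOrder p j), fun m j ↦ ?_, fun t ↦ ?_⟩
  · rw [Matrix.of_apply]
    generalize D.finOrder p m = s
    generalize D.finOrder p j = s'
    obtain ⟨v, k⟩ := s
    obtain ⟨v', k'⟩ := s'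
    by_cases h : v' = v
    · subst h
      rw [hV1]
      refine b.norm_repr_le_one v' ?_ k'
      rw [map_mul, hη, one_mul]
      exact b.valued_basis_le_one v' k
    · rw [hV0 _ _ h, norm_zero]
      exact zero_le_one
  · let l : Fin n → ℚ_[p] := fun j ↦ padicAbs p (D.finOrder p j).1 (ε : F)
    let τ : Fin n → ℚ_[p] := fun j ↦ ((p : ℕ) : ℚ_[p]) ^ e (D.finOrder p j).1 *
      ((((t (D.finOrder p j).1)⁻¹ : PrimePow p) : ℚˣ) : ℚ)
    have hR : finMatrix w D p e ((absMap F S ε).2 p * t) =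
        Matrix.of fun i j ↦ (l j * τ j) * b.coord (D.finOrder p j) (w i) := by
      ext i j
      have h1 : ((((((absMap F S ε).2 p * t) (D.finOrder p j).1)⁻¹ : PrimePow p) : ℚˣ) : ℚ) =
          ((p : ℕ) : ℚ) ^ (-WithZero.log ((D.finOrder p j).1.1.valuation F (ε : F))) *
            ((((t (D.finOrder p j).1)⁻¹ : PrimePow p) : ℚˣ) : ℚ) := by
        rw [Pi.mul_apply, mul_inv, Subgroup.coe_mul, Units.val_mul, Subgroup.coe_inv,
          absMap_snd_val, ← zpow_neg, Units.val_zpow_eq_zpow_val]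
        rfl
      simp only [finMatrix, Matrix.of_apply, h1, l, τ, padicAbs, b]
      push_cast
      ring
    rw [hR]
    refine mul_of_scaled_coord A _ (fun j a ↦ b.coord (D.finOrder p j) a) w ε l τ ?_ ?_ ?_
    · intro i j
      rw [b.coord_eq_sum w]
      exact Finset.sum_congr rfl fun m _ ↦ by rw [hA]
    · intro i j
      simp only [Matrix.of_apply, l]
      rw [Equiv.sum_comp (D.finOrder p) fun s ↦ b.coord s (w i) *
        (padicAbs p (D.finOrder p j).1 (ε : F) * V s (D.finOrder p j))]
      generalize D.finOrder p j = s'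
      obtain ⟨v, k'⟩ := s'
      rw [Fintype.sum_sigma, Finset.sum_eq_single v]
      · simp only [hV1]
        change (b.basis v).repr (algebraMap F _ (ε * w i)) k' = ∑ k,
          (b.basis v).repr (algebraMap F _ (w i)) k * _
        rw [map_mul, hη']
        conv_lhs => rw [← (b.basis v).sum_repr (algebraMap F _ (w i))]
        rw [Finset.mul_sum, map_smul, map_sum, Finsupp.smul_apply, Finsupp.finsetSum_apply,
          smul_eq_mul, Finset.mul_sum]
        refine Finset.sum_congr rfl fun k _ ↦ ?_
        rw [mul_smul_comm, map_smul, Finsupp.smul_apply, smul_eq_mul]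
        ring
      · intro v' _ hv'
        refine Finset.sum_eq_zero fun k _ ↦ ?_
        rw [hV0 _ _ hv'.symm, mul_zero, mul_zero]
      · intro h
        exact absurd (Finset.mem_univ _) h
    · intro m j h
      rw [Matrix.of_apply] at h
      have h1 : (D.finOrder p j).1 = (D.finOrder p m).1 := by
        by_contra h1
        exact h (hV0 _ _ h1)
      simp only [l, τ, h1, and_self]

/-- The scaling by `t` contributes the product of the t_v^(-n_v), which is 1. -/
theorem det_finMatrix (w : Basis (Fin n) ℚ F) (D : Frame F S n) (p : S)
    (e : PlaceAbove F p → ℤ) (t : PlaceAbove F p → PrimePow p)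
    (ht : ∏ v : PlaceAbove F p, t v ^ finrank ℚ_[p] (v.1.adicCompletion F) = 1) :
    (finMatrix w D p e t).det = (finMatrix w D p e 1).det := by
  have hprod : ∏ j, (((((t (D.finOrder p j).1)⁻¹ : PrimePow p) : ℚˣ) : ℚ) : ℚ_[p]) = 1 := by
    have h1 : ∏ j, t (D.finOrder p j).1 = 1 := by
      rw [Equiv.prod_comp (D.finOrder p) fun s ↦ t s.1, Fintype.prod_sigma, ← ht]
      exact Finset.prod_congr rfl fun v _ ↦ by simp
    have h2 : ∏ j, (t (D.finOrder p j).1)⁻¹ = 1 := by rw [Finset.prod_inv_distrib, h1, inv_one]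
    let φ : PrimePow p →* ℚ_[p] :=
      ((algebraMap ℚ ℚ_[p] : ℚ →* ℚ_[p]).comp (Units.coeHom ℚ)).comp (Subgroup.subtype _)
    have h3 := congrArg φ h2
    rw [map_prod, map_one] at h3
    exact h3
  have h1 : finMatrix w D p e t = Matrix.of fun i j ↦
      (((((t (D.finOrder p j).1)⁻¹ : PrimePow p) : ℚˣ) : ℚ) : ℚ_[p]) * finMatrix w D p e 1 i j := by
    ext i j
    simp only [finMatrix, Matrix.of_apply, Pi.one_apply, inv_one, Subgroup.coe_one, Units.val_one,
      Rat.cast_one]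
    ring
  rw [h1, Matrix.det_mul_row, hprod, one_mul]

theorem exists_gammaS_repr (w : Basis (Fin n) ℚ F) {ε : Fˣ} (hε : ε ∈ normOneUnits w S) :
    ∃ A : GammaS n S, ∀ i m, ((A.1 i m : ZInv S) : ℚ) = w.repr ((ε : F) * w i) m := by
  have h := (mem_multiplierOrder_iff w S _).1 hε.1
  let A : Matrix (Fin n) (Fin n) (ZInv S) := Matrix.of fun i m ↦ ⟨w.repr ((ε : F) * w i) m, h i m⟩
  have hdet : A.det = 1 := by
    apply Subtype.val_injective
    -- `A` acts on the column vector `w`, hence the transpose; its determinant is the norm of ε.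
    have h1 : (A.map (ZInv S).subtype)ᵀ = Algebra.leftMulMatrix w (ε : F) := by
      ext i m
      rw [Algebra.leftMulMatrix_eq_repr_mul]
      rfl
    have h2 := (ZInv S).subtype.map_det A
    rw [RingHom.mapMatrix_apply, ← Matrix.det_transpose (A.map _), h1, ← Algebra.norm_eq_matrix_det w,
      hε.2.2] at h2
    exact h2
  exact ⟨⟨A, hdet⟩, fun i m ↦ rfl⟩

theorem mem_orthogonalSubgroup {g : GL (Fin n) ℝ} (h : g.1 * g.1ᵀ = 1) :
    g ∈ orthogonalSubgroup n := by
  refine ⟨⟨g.1, ?_⟩, Units.ext rfl⟩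
  rw [Unitary.mem_iff]
  exact ⟨mul_eq_one_comm.1 h, h⟩

theorem mem_integralSubgroup {p : Nat.Primes} {g : GL (Fin n) ℚ_[p]} (h : ∀ i j, ‖g.1 i j‖ ≤ 1)
    (hdet : g.1.det = 1) : g ∈ integralSubgroup n p := by
  let B : Matrix (Fin n) (Fin n) ℤ_[p] := Matrix.of fun i j ↦ ⟨g.1 i j, h i j⟩
  have hB : B.map (algebraMap ℤ_[p] ℚ_[p]) = g.1 := rfl
  have hBdet : B.det = 1 := by
    apply FaithfulSMul.algebraMap_injective ℤ_[p] ℚ_[p]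
    rw [RingHom.map_det, RingHom.mapMatrix_apply, hB, hdet, map_one]
  refine ⟨Matrix.SpecialLinearGroup.toGL ⟨B, hBdet⟩, Units.ext ?_⟩
  exact hB

/-- The matrix of multiplication by ε moves the Heegner matrices by `r` up to a right factor `U`,
which is orthogonal at infinity and integral at `p`, so the cosets agree. -/
theorem mem_periodGroup_of_mem_normOneUnits (w : Basis (Fin n) ℚ F) (D : Frame F S n)
    (e : ∀ p : S, PlaceAbove F p → ℤ)
    (hS : ∀ p ∈ S, ∀ v : PlaceAbove F p, Algebra.IsUnramifiedAt ℤ v.1.asIdeal)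
    {ε : Fˣ} (hε : ε ∈ normOneUnits w S) {r : T1 F S} (hr : absMap F S ε = r) :
    r ∈ periodGroup w D e := by
  obtain ⟨A, hA⟩ := exists_gammaS_repr w hε
  refine ⟨A, fun t ↦ Prod.ext ?_ (funext fun p ↦ ?_)⟩
  · obtain ⟨U, hU, hmul⟩ := exists_orthogonal_mul_infMatrix (S := S) w D ε (gammaTo n S ℝ A).1
      fun i m ↦ congrArg (Rat.cast : ℚ → ℝ) (hA i m)
    rw [hr] at hmul
    have hUdet : U.det ≠ 0 := by
      intro h0
      have := congrArg Matrix.det hU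
      rw [Matrix.det_mul, h0, zero_mul, Matrix.det_one] at this
      exact zero_ne_one this
    let g := Matrix.GeneralLinearGroup.mkOfDetNeZero U hUdet
    have hg : g ∈ orthogonalSubgroup n := mem_orthogonalSubgroup hU
    have heq : gammaTo n S ℝ A * Matrix.GeneralLinearGroup.mkOfDetNeZero (infMatrix w D t.1.1)
          (infMatrix_det_ne_zero w D t.1.1) =
        Matrix.GeneralLinearGroup.mkOfDetNeZero (infMatrix w D (r * t).1.1)
          (infMatrix_det_ne_zero w D (r * t).1.1) * g := Units.ext (hmul t.1.1)
    change ((gammaTo n S ℝ A * Matrix.GeneralLinearGroup.mkOfDetNeZero (infMatrix w D t.1.1)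
      (infMatrix_det_ne_zero w D t.1.1) : GL (Fin n) ℝ) : HInf n) = _
    rw [heq]
    exact QuotientGroup.mk_mul_of_mem _ (Subgroup.mem_sup_right hg)
  · obtain ⟨U, hU, hmul⟩ := exists_integral_mul_finMatrix w D p (e p) (hS p p.2) ε
      (gammaTo n S ℚ_[p] A).1 fun i m ↦ congrArg (Rat.cast : ℚ → ℚ_[p]) (hA i m)
    rw [hr] at hmul
    -- `A` has determinant 1 and both Heegner matrices have the same determinant; this makes the
    -- integral matrix `U` invertible over ℤ_p.
    have hUdet : U.det = 1 := by
      have h1 := congrArg Matrix.det (hmul (t.1.2 p))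
      have h2 : ((gammaTo n S ℚ_[p] A).1).det = 1 :=
        (Matrix.SpecialLinearGroup.map ((algebraMap ℚ ℚ_[p]).comp (ZInv S).subtype) A).2
      have h3 := det_finMatrix w D p (e p) (r.1.2 p * t.1.2 p) ((r * t).2.2 p)
      rw [Matrix.det_mul, Matrix.det_mul, h2, one_mul, h3, det_finMatrix w D p (e p) _ (t.2.2 p)] at h1
      exact (mul_eq_left₀ (finMatrix_det_ne_zero w D p (e p) 1)).1 h1.symm
    let g := Matrix.GeneralLinearGroup.mkOfDetNeZero U (hUdet.trans_ne one_ne_zero)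
    have hg : g ∈ integralSubgroup n p := mem_integralSubgroup hU hUdet
    have heq : gammaTo n S ℚ_[p] A * Matrix.GeneralLinearGroup.mkOfDetNeZero
          (finMatrix w D p (e p) (t.1.2 p)) (finMatrix_det_ne_zero w D p (e p) (t.1.2 p)) =
        Matrix.GeneralLinearGroup.mkOfDetNeZero (finMatrix w D p (e p) ((r * t).1.2 p))
          (finMatrix_det_ne_zero w D p (e p) ((r * t).1.2 p)) * g := Units.ext (hmul (t.1.2 p))
    change ((gammaTo n S ℚ_[p] A * Matrix.GeneralLinearGroup.mkOfDetNeZero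
      (finMatrix w D p (e p) (t.1.2 p)) (finMatrix_det_ne_zero w D p (e p) (t.1.2 p)) :
      GL (Fin n) ℚ_[p]) : HFin n p) = _
    rw [heq]
    exact QuotientGroup.mk_mul_of_mem _ (Subgroup.mem_sup_right hg)

theorem unitLattice_le_periodGroup (w : Basis (Fin n) ℚ F) (D : Frame F S n)
    (e : ∀ p : S, PlaceAbove F p → ℤ)
    (hS : ∀ p ∈ S, ∀ v : PlaceAbove F p, Algebra.IsUnramifiedAt ℤ v.1.asIdeal) :
    unitLattice w S ≤ periodGroup w D e := by
  rintro r ⟨ε, hε, hr⟩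
  exact mem_periodGroup_of_mem_normOneUnits w D e hS hε hr

end

/-! ### Topology of the parameter space -/

instance primePow_discreteTopology (p : Nat.Primes) : DiscreteTopology (PrimePow p) := by
  refine discreteTopology_of_isOpen_singleton_one ?_
  have hcont : Continuous fun x : PrimePow p ↦ ((x : ℚˣ) : ℚ) :=
    Units.continuous_val.comp continuous_subtype_val
  -- The only power of `p` strictly between 1/2 and 2 is 1, because `p ≥ 2`.
  have hopen := (isOpen_Ioo (a := (1 / 2 : ℚ)) (b := 2)).preimage hcont
  convert hopen using 1
  ext x
  constructor
  · rintro rfl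
    simp only [Set.mem_preimage, Subgroup.coe_one, Units.val_one, Set.mem_Ioo]
    norm_num
  · rintro ⟨h1, h2⟩
    obtain ⟨_, k, rfl⟩ := x
    have hp2 : (2 : ℚ) ≤ ((p : ℕ) : ℚ) := by exact_mod_cast p.2.two_le
    have hval : (((primeUnit p ^ k : ℚˣ)) : ℚ) = ((p : ℕ) : ℚ) ^ k := by
      rw [Units.val_zpow_eq_zpow_val]
      rfl
    change 1 / 2 < ((primeUnit p ^ k : ℚˣ) : ℚ) at h1
    change ((primeUnit p ^ k : ℚˣ) : ℚ) < 2 at h2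
    rw [hval] at h1 h2
    have hp1 : (1 : ℚ) < ((p : ℕ) : ℚ) := by linarith
    have hk1 : k < 1 := by
      by_contra! h
      have h3 := zpow_le_zpow_right₀ hp1.le h
      rw [zpow_one] at h3
      linarith
    have hk2 : -1 < k := by
      by_contra! h
      have h3 := zpow_le_zpow_right₀ hp1.le h
      rw [zpow_neg_one] at h3
      have h4 : ((p : ℕ) : ℚ)⁻¹ ≤ 2⁻¹ := inv_anti₀ (by norm_num) hp2
      linarith
    obtain rfl : k = 0 := by omega
    exact Subtype.ext (zpow_zero _)

section

variable {F : Type*} [Field F] [NumberField F] {S : Finset Nat.Primes}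

theorem isCompact_boundedTorus (F : Type*) [Field F] [NumberField F] (S : Finset Nat.Primes)
    (C : ℝ) : IsCompact (boundedTorus F S C) := by
  have h1 : IsCompact {x : {x : ℝ // 0 < x} | |Real.log x| ≤ C} := by
    rw [Subtype.isCompact_iff]
    convert isCompact_Icc (a := Real.exp (-C)) (b := Real.exp C) using 1
    ext y
    constructor
    · rintro ⟨x, hx, rfl⟩
      have hx' := abs_le.1 (show |Real.log x| ≤ C from hx)
      exact ⟨(Real.le_log_iff_exp_le x.2).1 hx'.1, (Real.log_le_iff_le_exp x.2).1 hx'.2⟩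
    · rintro ⟨hy1, hy2⟩
      have hy : 0 < y := (Real.exp_pos _).trans_le hy1
      exact ⟨⟨y, hy⟩, abs_le.2 ⟨(Real.le_log_iff_exp_le hy).2 hy1, (Real.log_le_iff_le_exp hy).2 hy2⟩,
        rfl⟩
  have h2 : ∀ p : Nat.Primes,
      IsCompact {x : PrimePow p | ∃ k : ℤ, |(k : ℝ)| ≤ C ∧ (x : ℚˣ) = primeUnit p ^ k} := by
    intro p
    refine Set.Finite.isCompact (Set.Finite.subset ((Set.finite_Icc (-⌊C⌋) ⌊C⌋).image
      fun k : ℤ ↦ (⟨primeUnit p ^ k, k, rfl⟩ : PrimePow p)) ?_)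
    rintro x ⟨k, hk, hx⟩
    refine ⟨k, ?_, Subtype.ext hx.symm⟩
    rw [← Int.cast_abs, ← Int.le_floor, abs_le] at hk
    exact hk
  convert (isCompact_univ_pi fun _ : InfinitePlace F ↦ h1).prod
    (isCompact_univ_pi fun p : S ↦ isCompact_univ_pi fun _ : PlaceAbove F p ↦ h2 p) using 1
  ext t
  simp [boundedTorus]

theorem isClosed_galTorus_eq_inv {F' : Type*} [Field F'] [Algebra F' F] (s : F ≃ₐ[F'] F) :
    IsClosed {t : TorusS F S | galTorus s t = t⁻¹} := by
  have h : {t : TorusS F S | galTorus s t = t⁻¹} =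
      {t | ∀ v, (t.1 (s⁻¹ • v) : ℝ) * t.1 v = 1} ∩
        {t | ∀ (p : S) (v : PlaceAbove F p), t.2 p (galPlace s⁻¹ v) * t.2 p v = 1} := by
    ext t
    rw [Set.mem_ofPred_eq, Prod.ext_iff, funext_iff]
    refine and_congr (forall_congr' fun v ↦ ?_) ?_
    · rw [Prod.fst_inv, Pi.inv_apply, eq_inv_iff_mul_eq_one, Subtype.ext_iff]
      rfl
    · rw [funext_iff]
      refine forall_congr' fun p ↦ ?_
      rw [funext_iff]
      refine forall_congr' fun v ↦ ?_
      rw [Prod.snd_inv, Pi.inv_apply, Pi.inv_apply, eq_inv_iff_mul_eq_one]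
      rfl
  rw [h]
  refine IsClosed.inter ?_ ?_
  · simp only [Set.ofPred_forall]
    exact isClosed_iInter fun v ↦ isClosed_eq (by fun_prop) continuous_const
  · simp only [Set.ofPred_forall]
    exact isClosed_iInter fun p ↦ isClosed_iInter fun v ↦ isClosed_eq (by fun_prop) continuous_const

variable {n : ℕ}

theorem continuous_mkOfDetNeZero {X : Type*} [TopologicalSpace X] {K : Type*} [Field K]
    [TopologicalSpace K] [IsTopologicalDivisionRing K] {f : X → Matrix (Fin n) (Fin n) K}
    (hf : Continuous f) (h : ∀ x, (f x).det ≠ 0) :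
    Continuous fun x ↦ Matrix.GeneralLinearGroup.mkOfDetNeZero (f x) (h x) := by
  rw [Units.continuous_iff]
  refine ⟨hf, ?_⟩
  -- The topology on units also requires continuity of the inverse, visible from the adjugate
  -- formula.
  have hinv : ∀ x, ((Matrix.GeneralLinearGroup.mkOfDetNeZero (f x) (h x))⁻¹ : GL (Fin n) K).1 =
      (f x).det⁻¹ • (f x).adjugate := by
    intro x
    rw [Matrix.coe_units_inv, Matrix.inv_def, Ring.inverse_eq_inv']
    rfl
  simp only [hinv]
  exact (hf.matrix_det.inv₀ h).smul hf.matrix_adjugate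

theorem continuous_heegner (w : Basis (Fin n) ℚ F) (D : Frame F S n)
    (e : ∀ p : S, PlaceAbove F p → ℤ) : Continuous (heegner w D e) := by
  refine Continuous.prodMk ?_ (continuous_pi fun p ↦ ?_)
  · refine continuous_quot_mk.comp (continuous_mkOfDetNeZero ?_ _)
    refine continuous_matrix fun i j ↦ ?_
    simp only [infMatrix, Matrix.of_apply]
    fun_prop
  · have h : Continuous fun t : PlaceAbove F p → PrimePow p ↦
        (QuotientGroup.mk (Matrix.GeneralLinearGroup.mkOfDetNeZero (finMatrix w D p (e p) t)
          (finMatrix_det_ne_zero w D p (e p) t)) : HFin n p) := continuous_of_discreteTopology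
    exact h.comp (f := fun t : T1 F S ↦ t.1.2 p) (by fun_prop)

end

/-! ### Cocompactness -/

section

variable {F' F : Type*} [Field F'] [NumberField F'] [Field F] [NumberField F] [Algebra F' F]

/-- A quadratic extension has at most two automorphisms, and a nontrivial character provides the
second one. -/
theorem exists_involution_of_ne_one [Algebra.IsQuadraticExtension F' F]
    {χ : (F ≃ₐ[F'] F) →* ℤˣ} (hχ : χ ≠ 1) :
    ∃ s : F ≃ₐ[F'] F, χ s = -1 ∧ s * s = 1 ∧ ∀ g, g = 1 ∨ g = s := by
  classical
  obtain ⟨s, hs⟩ : ∃ s, χ s ≠ 1 := by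
    by_contra! h
    exact hχ (MonoidHom.ext h)
  have hs1 : s ≠ 1 := by
    rintro rfl
    exact hs (map_one χ)
  have hcard : Fintype.card (F ≃ₐ[F'] F) ≤ 2 :=
    (AlgEquiv.card_le).trans_eq (Algebra.IsQuadraticExtension.finrank_eq_two F' F)
  have hall : ∀ g, g = 1 ∨ g = s := by
    intro g
    by_contra! h
    have h3 : ({1, s, g} : Finset (F ≃ₐ[F'] F)).card = 3 :=
      Finset.card_eq_three.2 ⟨1, s, g, hs1.symm, h.1.symm, h.2.symm, rfl⟩
    have := (Finset.card_le_univ ({1, s, g} : Finset (F ≃ₐ[F'] F))).trans hcard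
    omega
  refine ⟨s, (Int.units_eq_one_or _).resolve_left hs, ?_, hall⟩
  exact (hall (s * s)).resolve_right fun h ↦ hs1 (mul_eq_left.1 h)

variable {S : Finset Nat.Primes} {n : ℕ}

theorem exists_isCompact_mul_unitLattice [Algebra.IsQuadraticExtension F' F]
    {χ : (F ≃ₐ[F'] F) →* ℤˣ} (hχ : χ ≠ 1) (w : Basis (Fin n) ℚ F) (D : ∀ p : S, LocalFrame F p) :
    ∃ K : Set (chiComponent χ (⊤ : Subgroup (T1 F S))), IsCompact K ∧
      ∀ t, ∃ r : chiComponent χ (⊤ : Subgroup (T1 F S)),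
        (r : T1 F S) ∈ chiComponent χ (unitLattice w S) ∧ t / r ∈ K := by
  obtain ⟨s, hs, hs2, hall⟩ := exists_involution_of_ne_one hχ
  obtain ⟨k, hk, hkM⟩ := exists_pow_mem_multiplierOrder w S
  obtain ⟨C, hC⟩ := exists_div_absMap_mem_boundedTorus (S := S) s hs2 hk
  have hchi : ∀ t : TorusS F S, (∀ g, galTorus g t = t ^ ((χ g : ℤˣ) : ℤ)) ↔
      galTorus s t = t⁻¹ := by
    intro t
    refine ⟨fun h ↦ by simpa [hs] using h s, fun h g ↦ ?_⟩
    rcases hall g with rfl | rfl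
    · rw [map_one, Units.val_one, zpow_one]
      refine Prod.ext rfl (funext fun p ↦ funext fun v ↦ ?_)
      change t.2 p (galPlace (1 : F ≃ₐ[F'] F)⁻¹ v) = _
      rw [inv_one, galPlace_one]
    · simpa [hs] using h
  let ι : chiComponent χ (⊤ : Subgroup (T1 F S)) → TorusS F S := fun t ↦ t.1.1
  have hι : Topology.IsInducing ι :=
    Topology.IsInducing.subtypeVal.comp Topology.IsInducing.subtypeVal
  refine ⟨ι ⁻¹' boundedTorus F S C, ?_, fun t ↦ ?_⟩
  · rw [hι.isCompact_iff]
    -- In the full torus the image of the χ-component is exactly the closed anti-invariant locus,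
    -- because anti-invariance implies the product conditions.
    convert (isCompact_boundedTorus F S C).inter_right (isClosed_galTorus_eq_inv s) using 1
    ext t
    constructor
    · rintro ⟨t, ht, rfl⟩
      exact ⟨ht, (hchi _).1 t.2.2⟩
    · rintro ⟨ht, ht'⟩
      exact ⟨⟨⟨t, mem_T1_of_galTorus_eq_inv D s ht'⟩, Subgroup.mem_top _, (hchi t).2 ht'⟩, ht, rfl⟩
  · obtain ⟨x, hx, hxt⟩ := hC t.1.1 ((hchi _).1 t.2.2)
    have h1 := galTorus_absMap_divGal (S := S) hs2 x k
    let r : T1 F S := ⟨absMap F S (divGal s x ^ k), mem_T1_of_galTorus_eq_inv D s h1⟩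
    have hr : r ∈ unitLattice w S := ⟨_, divGal_pow_mem_normOneUnits w s hkM hx, rfl⟩
    exact ⟨⟨r, Subgroup.mem_top _, (hchi _).2 h1⟩, ⟨hr, (hchi _).2 h1⟩, hxt⟩

theorem compactSpace_quotient_of_isCompact {G : Type*} [CommGroup G] [TopologicalSpace G]
    {N : Subgroup G} {K : Set G} (hK : IsCompact K) (h : ∀ t, ∃ r ∈ N, t / r ∈ K) :
    CompactSpace (G ⧸ N) := by
  have himage : (QuotientGroup.mk : G → G ⧸ N) '' K = Set.univ := by
    refine Set.eq_univ_of_forall fun q ↦ ?_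
    obtain ⟨t, rfl⟩ := QuotientGroup.mk_surjective q
    obtain ⟨r, hr, htr⟩ := h t
    refine ⟨t / r, htr, QuotientGroup.eq.2 ?_⟩
    rwa [inv_div, div_mul_cancel]
  refine ⟨?_⟩
  rw [← himage]
  exact hK.image continuous_quot_mk

end

end Heegner

end

/-! ### Compactness of both quotients and of the image -/

theorem theorem2p10 {F' F : Type*} [Field F'] [NumberField F'] [Field F] [NumberField F]
    [Algebra F' F] [Algebra.IsQuadraticExtension F' F]
    (χ : (F ≃ₐ[F'] F) →* ℤˣ) (hχ : χ ≠ 1)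
    (S : Finset Nat.Primes)
    (hS : ∀ p ∈ S, ∀ v : Heegner.PlaceAbove F p, Algebra.IsUnramifiedAt ℤ v.1.asIdeal)
    {n : ℕ} (w : Module.Basis (Fin n) ℚ F) (D : Heegner.Frame F S n)
    (e : ∀ p : S, Heegner.PlaceAbove F p → ℤ) :
    -- compactness of the quotient, for the group of periods of the Heegner object
    CompactSpace (↥(Heegner.chiComponent χ (⊤ : Subgroup (Heegner.T1 F S))) ⧸
      (Heegner.chiComponent χ (Heegner.periodGroup w D e)).subgroupOf
        (Heegner.chiComponent χ ⊤)) ∧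
    -- and for the image of the norm one units under the absolute value map
    CompactSpace (↥(Heegner.chiComponent χ (⊤ : Subgroup (Heegner.T1 F S))) ⧸
      (Heegner.chiComponent χ (Heegner.unitLattice w S)).subgroupOf
        (Heegner.chiComponent χ ⊤)) ∧
    -- compactness of the image in the quotient by the arithmetic group
    IsCompact (Set.range fun t : ↥(Heegner.chiComponent χ (⊤ : Subgroup (Heegner.T1 F S))) ↦
      (Quotient.mk (MulAction.orbitRel (Heegner.GammaS n S) (Heegner.HS n S))
        (Heegner.heegner w D e t))) := by
  obtain ⟨K, hK, hKt⟩ := Heegner.exists_isCompact_mul_unitLattice hχ w D.local_frame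
  have hle := Heegner.unitLattice_le_periodGroup w D e hS
  refine ⟨?_, ?_, ?_⟩
  · refine Heegner.compactSpace_quotient_of_isCompact hK fun t ↦ ?_
    obtain ⟨r, hr, htr⟩ := hKt t
    exact ⟨r, Subgroup.mem_subgroupOf.2 ⟨hle hr.1, hr.2⟩, htr⟩
  · refine Heegner.compactSpace_quotient_of_isCompact hK fun t ↦ ?_
    obtain ⟨r, hr, htr⟩ := hKt t
    exact ⟨r, Subgroup.mem_subgroupOf.2 hr, htr⟩
  · have hcont : Continuous fun t : ↥(Heegner.chiComponent χ (⊤ : Subgroup (Heegner.T1 F S))) ↦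
        (Quotient.mk (MulAction.orbitRel (Heegner.GammaS n S) (Heegner.HS n S))
          (Heegner.heegner w D e t)) :=
      continuous_quot_mk.comp ((Heegner.continuous_heegner w D e).comp continuous_subtype_val)
    convert hK.image hcont using 1
    refine Set.Subset.antisymm ?_ (Set.image_subset_range _ _)
    rintro _ ⟨t, rfl⟩
    obtain ⟨r, hr, htr⟩ := hKt t
    obtain ⟨A, hA⟩ := hle hr.1
    -- The matrix `A` of the period `r` sends the point of `t / r` to that of `t`, so both have the
    -- same image and `K` already covers everything.
    refine ⟨t / r, htr, Quotient.sound ?_⟩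
    refine MulAction.orbitRel_apply.2 ⟨A⁻¹, ?_⟩
    change A⁻¹ • Heegner.heegner w D e t = _
    rw [inv_smul_eq_iff, hA]
    congr 1
    rw [Subgroup.coe_div, mul_div_cancel]
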